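/- Let $n\ge 3$ and let $P$ be the convex $n$-gon with vertices $0,\dots,n-1$ in cyclic order; an arc is an unordered pair of distinct vertices, and a dissection $\mathcal D$ of $P$ is a set of pairwise non-crossing arcs. A frieze on $P$ over an integral domain $R$ is a map $f:V\times V\to R$, $V=\{0,\dots,n-1\}$, such that $f(i,j)=0$ iff $i=j$; $f(i,i+1)=f(i,i-1)=1$; $f(i,j)=f(j,i)$; and $f(i,j)f(k,\ell)=f(i,\ell)f(j,k)+f(i,k)f(j,\ell)$ whenever the arcs $(i,j)$ and $(k,\ell)$ cross. It is unitary if there is a triangulation $T$ of $P$ such that $f(\tau)\in R^\times$ for every arc $\tau\in T$. If $\mathcal D$ divides $P$ into triangles and quadrilaterals, the frieze $f_{\mathcal D}$ from $\mathcal D$ is the unique frieze on $P$ over $\mathbb Z[\sqrt2]$ whose restriction to each subpolygon of $\mathcal D$, with vertices $v_0,\dots,v_{p-1}$ in order, is the Euclidean frieze $(v_a,v_b)\mapsto U_{|b-a|-1}(2\cos(\pi/p))$, where $U_{-1}(x)=0$, $U_0(x)=1$ and $U_k(x)=xU_{k-1}(x)-U_{k-2}(x)$. (So sides of subpolygons have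 weight $1$ and diagonals of quadrilaterals have weight $\sqrt2$.) For $k\ge0$, a $k$-tower is a dissection of a $(2k+3)$-gon which consists of one triangle and $k$ quadrilaterals such that no vertex is incident to more than two subpolygons. A dissection $\mathcal D$ is a gluing of towers if some subset of its arcs decomposes $P$ into subpolygons on each of which $\mathcal D$ restricts to a tower. Call a dissection into triangles and quadrilaterals separated if (1) there is at most one arc $\tau_a\in\mathcal D$ which borders both a triangle and a quadrilateral, and (2) if there is such an arc, then the quadrilateral which it borders has sides $\tau_a,\tau_b,\tau_c,\tau_d$ in cyclic order with $\tau_b$ and $\tau_d$ boundary edges of $P$. **Proposition.** Let $\mathcal D$ be a separated dissection of $P$ into triangles and quadrilaterals. Then the frieze $f_{\mathcal D}$ exists and is unique, and it is unitary if and only if $\mathcal D$ is a gluing of towers. -/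

import Mathlib

namespace PolygonFrieze

/-! The `n`-gon is the set `Fin n` of its vertices with the cyclic order of Mathlib:
`sbtw i k j` says that `i, k, j` are distinct and met in this order when one goes round.
An arc is an unordered pair `s(i, j)` of distinct vertices. -/

/-- The arcs `(i, j)` and `(k, l)` cross: cyclically `i < k < j < l` or `i < l < j < k`. -/
def Crosses {n : ℕ} (i j k l : Fin n) : Prop :=
  (sbtw i k j ∧ sbtw j l i) ∨ (sbtw i l j ∧ sbtw j k i)

/-- A boundary edge `(i, i + 1)` of the `n`-gon. -/
def IsBoundary {n : ℕ} [NeZero n] (e : Sym2 (Fin n)) : Prop :=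
  ∃ i : Fin n, e = s(i, i + 1)

/-- `j` is the next vertex after `i` when one goes round the convex polygon with vertex set `S`. -/
def FollowsIn {n : ℕ} (S : Finset (Fin n)) (i j : Fin n) : Prop :=
  i ∈ S ∧ j ∈ S ∧ i ≠ j ∧ ∀ k ∈ S, ¬ sbtw i k j

/-- `e` is a side of the convex polygon with vertex set `S`. -/
def IsSide {n : ℕ} (S : Finset (Fin n)) (e : Sym2 (Fin n)) : Prop :=
  ∃ i j : Fin n, FollowsIn S i j ∧ e = s(i, j)

/-- A dissection of the `n`-gon: a set of pairwise non-crossing arcs. -/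
structure Dissection (n : ℕ) where
  arcs : Set (Sym2 (Fin n))
  not_isDiag : ∀ e ∈ arcs, ¬ e.IsDiag
  not_crosses : ∀ i j k l : Fin n, s(i, j) ∈ arcs → s(k, l) ∈ arcs → ¬ Crosses i j k l

namespace Dissection

variable {n : ℕ} [NeZero n]

/-- `S` is the vertex set of one of the subpolygons into which `D` divides the `n`-gon: every side
of `S` is a boundary edge or an arc of `D`, and no diagonal of `S` is an arc of `D`. -/
def IsCell (D : Dissection n) (S : Finset (Fin n)) : Prop :=
  3 ≤ S.card ∧
  (∀ e, IsSide S e → IsBoundary e ∨ e ∈ D.arcs) ∧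
  (∀ i ∈ S, ∀ j ∈ S, s(i, j) ∈ D.arcs → IsSide S s(i, j))

/-- A dissection into triangles and quadrilaterals. -/
def IsTriQuad (D : Dissection n) : Prop :=
  ∀ S, D.IsCell S → S.card = 3 ∨ S.card = 4

/-- A triangulation: a dissection into triangles. -/
def IsTriangulation (D : Dissection n) : Prop :=
  ∀ S, D.IsCell S → S.card = 3

/-- The restriction of `D` to the polygon with vertex set `W` (whose sides are boundary edges or
arcs of `D`) is a `k`-tower for some `k ≥ 0`: `W` is a `(2k+3)`-gon that consists of one triangle
and `k` quadrilaterals of `D`, and no vertex is incident to more than two of them. -/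
def IsTowerOn (D : Dissection n) (W : Finset (Fin n)) : Prop :=
  ∃ k : ℕ, W.card = 2 * k + 3 ∧
    (∀ S, D.IsCell S → S ⊆ W → S.card = 3 ∨ S.card = 4) ∧
    {S | D.IsCell S ∧ S ⊆ W ∧ S.card = 3}.ncard = 1 ∧
    {S | D.IsCell S ∧ S ⊆ W ∧ S.card = 4}.ncard = k ∧
    ∀ v : Fin n, {S | D.IsCell S ∧ S ⊆ W ∧ v ∈ S}.ncard ≤ 2

/-- `D` is a gluing of towers: some of its arcs decompose the `n`-gon into subpolygons on each of
which `D` restricts to a tower. -/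
def IsGluingOfTowers (D : Dissection n) : Prop :=
  ∃ E : Dissection n, E.arcs ⊆ D.arcs ∧ ∀ W, E.IsCell W → D.IsTowerOn W

/-- The arc `e` of `D` borders the triangle `T` and the quadrilateral `Q` of `D`. -/
def Separates (D : Dissection n) (e : Sym2 (Fin n)) (T Q : Finset (Fin n)) : Prop :=
  e ∈ D.arcs ∧ D.IsCell T ∧ T.card = 3 ∧ IsSide T e ∧ D.IsCell Q ∧ Q.card = 4 ∧ IsSide Q e

/-- A separated dissection: at most one arc borders both a triangle and a quadrilateral, and the
two sides of that quadrilateral next to this arc are boundary edges of the polygon. -/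
def IsSeparated (D : Dissection n) : Prop :=
  {e | ∃ T Q, D.Separates e T Q}.Subsingleton ∧
  ∀ e T Q, D.Separates e T Q →
    ∃ w x y z : Fin n,
      FollowsIn Q w x ∧ FollowsIn Q x y ∧ FollowsIn Q y z ∧ FollowsIn Q z w ∧
      e = s(w, x) ∧ IsBoundary s(x, y) ∧ IsBoundary s(z, w)

end Dissection

/-- A frieze on the `n`-gon with values in `R`. -/
structure IsFrieze {n : ℕ} [NeZero n] {R : Type*} [CommRing R] (f : Fin n → Fin n → R) : Prop where
  eq_zero_iff : ∀ i j, f i j = 0 ↔ i = j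
  next : ∀ i, f i (i + 1) = 1
  prev : ∀ i, f i (i - 1) = 1
  symm : ∀ i j, f i j = f j i
  ptolemy : ∀ i j k l, Crosses i j k l → f i j * f k l = f i l * f j k + f i k * f j l

/-- A unitary frieze: the weights of the arcs of some triangulation are units. -/
def IsUnitary {n : ℕ} [NeZero n] {R : Type*} [CommRing R] (f : Fin n → Fin n → R) : Prop :=
  ∃ T : Dissection n, T.IsTriangulation ∧ ∀ i j, s(i, j) ∈ T.arcs → IsUnit (f i j)

/-- The Euclidean frieze of the `p`-gon at the vertices `a, b ∈ {0, …, p - 1}`, that is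
`U_{|b - a| - 1} (2 cos (π / p))`. Mathlib's `Polynomial.Chebyshev.S` is the normalized Chebyshev
polynomial of the second kind: `S (-1) = 0`, `S 0 = 1`, `S k = X * S (k - 1) - S (k - 2)`. -/
noncomputable def euclideanFrieze (p a b : ℕ) : ℝ :=
  (Polynomial.Chebyshev.S ℝ (|(b : ℤ) - (a : ℤ)| - 1)).eval (2 * Real.cos (Real.pi / p))

/-- The number of vertices of `S` before `i`: the label in `{0, …, |S| - 1}` of the vertex `i` of
the polygon with vertex set `S`. -/
def position {n : ℕ} (S : Finset (Fin n)) (i : Fin n) : ℕ :=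
  (S.filter (fun k => k < i)).card

/-- The embedding of `ℤ[√2]` into the real numbers. -/
noncomputable def sqrtTwoToReal : Zsqrtd 2 →+* ℝ :=
  Zsqrtd.toReal (by norm_num)

/-- `f` is the frieze from the dissection `D`: a frieze which restricts to the Euclidean frieze on
every subpolygon of `D`. -/
def IsFriezeFromDissection {n : ℕ} [NeZero n] (D : Dissection n)
    (f : Fin n → Fin n → Zsqrtd 2) : Prop :=
  IsFrieze f ∧
  ∀ S, D.IsCell S → ∀ i ∈ S, ∀ j ∈ S,
    sqrtTwoToReal (f i j) = euclideanFrieze S.card (position S i) (position S j)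

end PolygonFrieze

/-!
Number the vertices of the polygon linearly. A dissection is then a family of *edges* `x < y`
(arcs of the dissection and boundary edges) no two of which cross, and each edge other than
`(i, i + 1)` is the longest side of exactly one cell (`Dissection.exists_cell_below`,
`Dissection.IsCell.eq_of_extremes`). This allows induction on the length of edges.

*Existence and uniqueness.* In the linear order, a frieze is a function on the pairs `x ≤ y` with
the Ptolemy relation, and the frieze from a dissection has weight `1` on edges and `√2` on the
diagonals of quadrilaterals (`IsWeighting`). The Ptolemy relation holds for the determinants of any
family of vectors in the plane; such vectors are chosen along the cells in `exists_vectors`, and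
they are positive in the required sense by `IsWeighting.pos`. Uniqueness is `IsWeighting.unique`.

*Unitary friezes.* If no arc borders both a triangle and a quadrilateral, there are only triangles
(the frieze is unitary, the dissection consists of towers) or only quadrilaterals (neither holds).
Otherwise rotate the polygon so that the separating arc is `(0, m)`, the quadrilaterals lie below
it, and `t > m` is the third vertex of the adjacent triangle (`Dissection.IsNormalized`). Both
properties are equivalent to the quadrilaterals forming a ladder (`Dissection.IsLadder`): each is
glued to the opposite side of the one before.

* Among the quadrilaterals, vertices of different parity have integral weight, and vertices of the
  same parity have a weight divisible by `√2`. Hence a triangulation by arcs of unit weight has no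
  arc among the vertices of the quadrilaterals. An arithmetic argument with norms then shows that
  all of these vertices other than `0`, `1`, `m - 1` and `m` are joined to `t` in such a
  triangulation (`Dissection.IsNormalized.isUnit_of_triangulation`), and units at these arcs force
  a ladder (`Dissection.IsNormalized.isLadder_of_isUnit`).
* In a ladder, the weights of the arcs from `t` to the ladder are the powers of `1 + √2`, so that
  they yield a triangulation by arcs of unit weight
  (`Dissection.IsNormalized.exists_triangulation_of_isUnit`).
* Each tower contains a triangle, so in a gluing of towers all quadrilaterals belong to the same
  tower, which must be the ladder with the triangle at its end
  (`Dissection.IsNormalized.isLadder_of_isGluingOfTowers`,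
  `Dissection.IsNormalized.isGluingOfTowers_of_isLadder`).
-/

namespace PolygonFrieze

/-! ### Edges and cells in the linear order of the vertices -/

section Cells

variable {n : ℕ}

theorem sbtw_iff (a b c : Fin n) :
    sbtw a b c ↔ a < b ∧ b < c ∨ b < c ∧ c < a ∨ c < a ∧ a < b := Iff.rfl

theorem followsIn_iff_of_lt {S : Finset (Fin n)} {x y : Fin n} (h : x < y) :
    FollowsIn S x y ↔ x ∈ S ∧ y ∈ S ∧ ∀ k ∈ S, ¬ (x < k ∧ k < y) := by
  simp only [FollowsIn, sbtw_iff]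
  constructor
  · rintro ⟨hx, hy, -, hk⟩
    exact ⟨hx, hy, fun k hkS hkk => hk k hkS (Or.inl hkk)⟩
  · rintro ⟨hx, hy, hk⟩
    exact ⟨hx, hy, by omega, fun k hkS hkk => hk k hkS (by omega)⟩

theorem followsIn_iff_of_gt {S : Finset (Fin n)} {x y : Fin n} (h : x < y) :
    FollowsIn S y x ↔ x ∈ S ∧ y ∈ S ∧ ∀ k ∈ S, x ≤ k ∧ k ≤ y := by
  simp only [FollowsIn, sbtw_iff]
  constructor
  · rintro ⟨hx, hy, -, hk⟩
    refine ⟨hy, hx, fun k hkS => ?_⟩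
    have := hk k hkS
    omega
  · rintro ⟨hx, hy, hk⟩
    refine ⟨hy, hx, by omega, fun k hkS hkk => ?_⟩
    have := hk k hkS
    omega

theorem isSide_mk_iff {S : Finset (Fin n)} {x y : Fin n} :
    IsSide S s(x, y) ↔ FollowsIn S x y ∨ FollowsIn S y x := by
  constructor
  · rintro ⟨i, j, h, e⟩
    rcases Sym2.eq_iff.1 e with ⟨rfl, rfl⟩ | ⟨rfl, rfl⟩
    · exact Or.inl h
    · exact Or.inr h
  · rintro (h | h)
    · exact ⟨x, y, h, rfl⟩
    · exact ⟨y, x, h, Sym2.eq_swap⟩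

theorem isSide_iff {S : Finset (Fin n)} {x y : Fin n} (h : x < y) :
    IsSide S s(x, y) ↔ x ∈ S ∧ y ∈ S ∧
      ((∀ k ∈ S, ¬ (x < k ∧ k < y)) ∨ ∀ k ∈ S, x ≤ k ∧ k ≤ y) := by
  rw [isSide_mk_iff, followsIn_iff_of_lt h, followsIn_iff_of_gt h]
  tauto

variable [NeZero n]

theorem isBoundary_iff {x y : Fin n} (h : x < y) :
    IsBoundary s(x, y) ↔ y.val = x.val + 1 ∨ (x.val = 0 ∧ y.val + 1 = n) := by
  have hn : 1 < n := by omega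
  have h1 : ((1 : Fin n) : ℕ) = 1 := by
    rw [Fin.val_one']; exact Nat.mod_eq_of_lt hn
  have key : ∀ i : Fin n, ((i + 1 : Fin n) : ℕ) = if i.val + 1 = n then 0 else i.val + 1 := by
    intro i
    rw [Fin.val_add, h1]
    split_ifs with hi
    · rw [hi, Nat.mod_self]
    · exact Nat.mod_eq_of_lt (by omega)
  constructor
  · rintro ⟨i, e⟩
    have := key i
    rcases Sym2.eq_iff.1 e with ⟨rfl, rfl⟩ | ⟨rfl, rfl⟩ <;> split_ifs at this <;> omega
  · rintro (h1 | h1)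
    · refine ⟨x, ?_⟩
      have := key x
      rw [if_neg (by omega)] at this
      rw [show y = x + 1 from Fin.ext (by omega)]
    · refine ⟨y, ?_⟩
      have := key y
      rw [if_pos (by omega)] at this
      rw [show x = y + 1 from Fin.ext (by omega), Sym2.eq_swap]

namespace Dissection

/-- `D.Edge x y`: the vertices `x < y` are joined by a boundary edge of the polygon or by an arc
of `D`. The edge from the first to the last vertex is always present. -/
def Edge (D : Dissection n) (x y : Fin n) : Prop :=
  x < y ∧ (IsBoundary s(x, y) ∨ s(x, y) ∈ D.arcs)

variable {D : Dissection n}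

theorem edge_succ (D : Dissection n) {x y : Fin n} (h : y.val = x.val + 1) : D.Edge x y := by
  have hxy : x < y := by omega
  exact ⟨hxy, Or.inl ((isBoundary_iff hxy).2 (Or.inl h))⟩

theorem edge_root (D : Dissection n) {x y : Fin n} (hxy : x < y) (hx : x.val = 0)
    (hy : y.val + 1 = n) : D.Edge x y :=
  ⟨hxy, Or.inl ((isBoundary_iff hxy).2 (Or.inr ⟨hx, hy⟩))⟩

theorem edge_of_mem {x y : Fin n} (hxy : x < y) (h : s(x, y) ∈ D.arcs) : D.Edge x y :=
  ⟨hxy, Or.inr h⟩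

theorem Edge.lt {x y : Fin n} (h : D.Edge x y) : x < y := h.1

theorem Edge.cases {x y : Fin n} (h : D.Edge x y) :
    y.val = x.val + 1 ∨ (x.val = 0 ∧ y.val + 1 = n) ∨ s(x, y) ∈ D.arcs := by
  rcases h with ⟨hxy, h | h⟩
  · rw [isBoundary_iff hxy] at h
    tauto
  · tauto

theorem Edge.not_cross {a b c d : Fin n} (h₁ : D.Edge a c) (h₂ : D.Edge b d) (hab : a < b)
    (hbc : b < c) (hcd : c < d) : False := by
  rcases h₁.cases with h | h | h
  · omega
  · omega
  rcases h₂.cases with h' | h' | h'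
  · omega
  · omega
  refine D.not_crosses a c b d h h' (Or.inl ⟨?_, ?_⟩) <;> rw [sbtw_iff] <;> omega

/-- Cells in terms of the linear order: two vertices of a cell are joined by an edge exactly if no
vertex of the cell lies strictly between them, or if they are its first and last vertex. -/
theorem isCell_iff {S : Finset (Fin n)} :
    D.IsCell S ↔ 3 ≤ S.card ∧ ∀ x ∈ S, ∀ y ∈ S, x < y →
      (D.Edge x y ↔ ((∀ k ∈ S, ¬ (x < k ∧ k < y)) ∨ ∀ k ∈ S, x ≤ k ∧ k ≤ y)) := by
  constructor
  · rintro ⟨h3, hs, hd⟩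
    refine ⟨h3, fun x hx y hy hxy => ⟨fun h => ?_, fun h => ⟨hxy, ?_⟩⟩⟩
    · rcases h.cases with h | h | h
      · exact Or.inl fun k _ hk => by omega
      · exact Or.inr fun k _ => by omega
      · exact ((isSide_iff hxy).1 (hd x hx y hy h)).2.2
    · exact hs _ ((isSide_iff hxy).2 ⟨hx, hy, h⟩)
  · rintro ⟨h3, h⟩
    have key : ∀ x ∈ S, ∀ y ∈ S, x < y → s(x, y) ∈ D.arcs → IsSide S s(x, y) :=
      fun x hx y hy hxy hD =>
        (isSide_iff hxy).2 ⟨hx, hy, (h x hx y hy hxy).1 (edge_of_mem hxy hD)⟩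
    refine ⟨h3, ?_, fun x hx y hy hD => ?_⟩
    · rintro _ ⟨x, y, hf, rfl⟩
      have hs : IsSide S s(x, y) := ⟨x, y, hf, rfl⟩
      rcases lt_or_gt_of_ne hf.2.2.1 with hxy | hxy
      · exact ((h x hf.1 y hf.2.1 hxy).2 ((isSide_iff hxy).1 hs).2.2).2
      · rw [Sym2.eq_swap] at hs ⊢
        exact ((h y hf.2.1 x hf.1 hxy).2 ((isSide_iff hxy).1 hs).2.2).2
    · rcases lt_trichotomy x y with hxy | rfl | hxy
      · exact key x hx y hy hxy hD
      · exact absurd rfl (D.not_isDiag _ hD)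
      · rw [Sym2.eq_swap] at hD ⊢
        exact key y hy x hx hxy hD

omit [NeZero n] in
theorem exists_eq_triple {S : Finset (Fin n)} (h : S.card = 3) :
    ∃ a b c, a < b ∧ b < c ∧ S = {a, b, c} := by
  obtain ⟨x, y, z, hxy, hxz, hyz, rfl⟩ := Finset.card_eq_three.1 h
  rcases lt_or_gt_of_ne hxy with h1 | h1 <;> rcases lt_or_gt_of_ne hxz with h2 | h2 <;>
    rcases lt_or_gt_of_ne hyz with h3 | h3
  · exact ⟨x, y, z, h1, h3, rfl⟩
  · exact ⟨x, z, y, h2, h3, by ext; simp; tauto⟩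
  · omega
  · exact ⟨z, x, y, h2, h1, by ext; simp; tauto⟩
  · exact ⟨y, x, z, h1, h2, by ext; simp; tauto⟩
  · omega
  · exact ⟨y, z, x, h3, h2, by ext; simp; tauto⟩
  · exact ⟨z, y, x, h3, h1, by ext; simp; tauto⟩

omit [NeZero n] in
theorem exists_eq_quadruple {S : Finset (Fin n)} (h : S.card = 4) :
    ∃ a b c d, a < b ∧ b < c ∧ c < d ∧ S = {a, b, c, d} := by
  have hne : S.Nonempty := Finset.card_pos.1 (by omega)
  have hmem := S.min'_mem hne
  obtain ⟨b, c, d, hbc, hcd, hS⟩ := exists_eq_triple (S := S.erase (S.min' hne))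
    (by rw [Finset.card_erase_of_mem hmem, h])
  refine ⟨S.min' hne, b, c, d, ?_, hbc, hcd, ?_⟩
  · have hb : b ∈ S.erase (S.min' hne) := by rw [hS]; simp
    exact Finset.min'_lt_of_mem_erase_min' S hne hb
  · rw [← hS, Finset.insert_erase hmem]

omit [NeZero n] in
theorem card_triple {a b c : Fin n} (h1 : a < b) (h2 : b < c) :
    ({a, b, c} : Finset (Fin n)).card = 3 :=
  Finset.card_eq_three.2 ⟨a, b, c, by omega, by omega, by omega, rfl⟩

omit [NeZero n] in
theorem card_quadruple {a b c d : Fin n} (h1 : a < b) (h2 : b < c) (h3 : c < d) :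
    ({a, b, c, d} : Finset (Fin n)).card = 4 := by
  rw [Finset.card_insert_of_notMem, card_triple h2 h3]
  simp only [Finset.mem_insert, Finset.mem_singleton]
  omega

theorem isCell_triple {a b c : Fin n} (h1 : a < b) (h2 : b < c) :
    D.IsCell {a, b, c} ↔ D.Edge a b ∧ D.Edge b c ∧ D.Edge a c := by
  rw [isCell_iff, card_triple h1 h2]
  simp only [Finset.mem_insert, Finset.mem_singleton, forall_eq_or_imp, forall_eq]
  grind

theorem isCell_quadruple {a b c d : Fin n} (h1 : a < b) (h2 : b < c) (h3 : c < d) :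
    D.IsCell {a, b, c, d} ↔ D.Edge a b ∧ D.Edge b c ∧ D.Edge c d ∧ D.Edge a d ∧
      ¬ D.Edge a c ∧ ¬ D.Edge b d := by
  rw [isCell_iff, card_quadruple h1 h2 h3]
  simp only [Finset.mem_insert, Finset.mem_singleton, forall_eq_or_imp, forall_eq]
  grind

omit [NeZero n] in
/-- Two consecutive vertices around a missing vertex. -/
theorem exists_consecutive {S : Finset (Fin n)} {i j x : Fin n} (hi : i ∈ S) (hj : j ∈ S)
    (hx : x ∉ S) (hix : i ≤ x) (hxj : x ≤ j) :
    ∃ p ∈ S, ∃ q ∈ S, p < x ∧ x < q ∧ ∀ k ∈ S, ¬ (p < k ∧ k < q) := by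
  have hix : i < x := lt_of_le_of_ne hix fun h => hx (h ▸ hi)
  have hxj : x < j := lt_of_le_of_ne hxj fun h => hx (h ▸ hj)
  obtain ⟨p, hp, hpm⟩ := (S.filter (· < x)).exists_max_image id ⟨i, by simp [hi, hix]⟩
  obtain ⟨q, hq, hqm⟩ := (S.filter (x < ·)).exists_min_image id ⟨j, by simp [hj, hxj]⟩
  simp only [Finset.mem_filter, id, and_imp] at hp hpm hq hqm
  refine ⟨p, hp.1, q, hq.1, hp.2, hq.2, fun k hk hkk => ?_⟩
  rcases lt_trichotomy k x with h | rfl | h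
  · have := hpm k hk h
    omega
  · exact hx hk
  · have := hqm k hk h
    omega

/-- Each edge which is not of the form `(i, i + 1)` is the longest side of a cell; this cell
consists of all vertices which are not cut off by a shorter edge. -/
theorem exists_cell_below {i j : Fin n} (h : D.Edge i j) (hij : i.val + 1 < j.val) :
    ∃ S, D.IsCell S ∧ i ∈ S ∧ j ∈ S ∧ (∀ k ∈ S, i ≤ k ∧ k ≤ j) ∧
      ∀ k, i ≤ k → k ≤ j →
        (∀ a b, D.Edge a b → i ≤ a → b ≤ j → a < k → k < b → a = i ∧ b = j) → k ∈ S := by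
  classical
  let C : Fin n → Prop := fun k =>
    ∀ a b, D.Edge a b → i ≤ a → b ≤ j → a < k → k < b → a = i ∧ b = j
  let S : Finset (Fin n) := Finset.univ.filter fun k => i ≤ k ∧ k ≤ j ∧ C k
  have hS : ∀ k, k ∈ S ↔ i ≤ k ∧ k ≤ j ∧ C k := fun k => by simp [S]
  have hi : i ∈ S := (hS i).2 ⟨le_rfl, h.lt.le, fun a b _ h1 _ h3 _ => by omega⟩
  have hj : j ∈ S := (hS j).2 ⟨h.lt.le, le_rfl, fun a b _ _ h1 _ h3 => by omega⟩
  -- the longest edge that starts at `x` and stays below `(i, j)` ends at the next vertex of `S`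
  have next : ∀ x ∈ S, ∀ y ∈ S, x < y → (∀ k ∈ S, ¬ (x < k ∧ k < y)) →
      D.Edge x y ∧ ¬ (x = i ∧ y = j) := by
    intro x hx y hy hxy hk
    have hx' := (hS x).1 hx
    have hy' := (hS y).1 hy
    obtain ⟨x1, hx1⟩ : ∃ x1 : Fin n, x1.val = x.val + 1 := ⟨⟨x.val + 1, by omega⟩, rfl⟩
    obtain ⟨b, hb, hbm⟩ := (Finset.univ.filter fun b =>
      D.Edge x b ∧ b ≤ j ∧ ¬ (x = i ∧ b = j)).exists_max_image id
      ⟨x1, by simp only [Finset.mem_filter, Finset.mem_univ, true_and]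
              exact ⟨D.edge_succ hx1, by omega, by omega⟩⟩
    simp only [Finset.mem_filter, Finset.mem_univ, true_and, id, and_imp] at hb hbm
    have hxb := hb.1.lt
    have hby : b = y := by
      rcases lt_trichotomy b y with hby | hby | hby
      · exfalso
        have hbS : b ∉ S := fun hbS => hk b hbS ⟨hxb, hby⟩
        rw [hS] at hbS
        push Not at hbS
        have := hbS (by omega) (by omega)
        simp only [C] at this
        push Not at this
        obtain ⟨a, c, hac, h1, h2, h3, h4, h5⟩ := this
        have hax : a = x := by
          rcases lt_trichotomy a x with hax | hax | hax
          · have := hx'.2.2 a c hac h1 h2 hax (by omega)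
            exact absurd this.2 (h5 this.1)
          · exact hax
          · exact (hb.1.not_cross hac hax h3 h4).elim
        subst hax
        have := hbm c hac h2 (fun e => h5 e.1 e.2)
        omega
      · exact hby
      · exact absurd (hy'.2.2 x b hb.1 hx'.1 hb.2.1 hxy hby) hb.2.2
    subst hby
    exact ⟨hb.1, hb.2.2⟩
  refine ⟨S, ?_, hi, hj, fun k hk => ⟨((hS k).1 hk).1, ((hS k).1 hk).2.1⟩,
    fun k h1 h2 h3 => (hS k).2 ⟨h1, h2, h3⟩⟩
  rw [isCell_iff]
  constructor
  · by_contra hcard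
    have hsub : ({i, j} : Finset (Fin n)) = S := by
      refine Finset.eq_of_subset_of_card_le (by simp [Finset.insert_subset_iff, hi, hj]) ?_
      rw [Finset.card_pair h.lt.ne]
      omega
    refine (next i hi j hj h.lt fun k hk => ?_).2 ⟨rfl, rfl⟩
    rw [← hsub] at hk
    simp only [Finset.mem_insert, Finset.mem_singleton] at hk
    omega
  · intro x hx y hy hxy
    have hx' := (hS x).1 hx
    have hy' := (hS y).1 hy
    constructor
    · intro e
      by_cases hxy' : x = i ∧ y = j
      · exact Or.inr fun k hk => by have := (hS k).1 hk; omega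
      · exact Or.inl fun k hk hkk =>
          hxy' (((hS k).1 hk).2.2 x y e hx'.1 hy'.2.1 hkk.1 hkk.2)
    · rintro (hk | hk)
      · exact (next x hx y hy hxy hk).1
      · have h1 := hk i hi
        have h2 := hk j hj
        rw [show x = i by omega, show y = j by omega]
        exact h

theorem IsCell.subset_of_extremes {S S' : Finset (Fin n)} (h : D.IsCell S) (h' : D.IsCell S')
    {i j : Fin n} (hi : i ∈ S) (hj : j ∈ S) (hij : ∀ k ∈ S, i ≤ k ∧ k ≤ j)
    (hi' : i ∈ S') (hj' : j ∈ S') (hij' : ∀ k ∈ S', i ≤ k ∧ k ≤ j) : S ⊆ S' := by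
  intro x hx
  by_contra hxS
  rw [isCell_iff] at h h'
  obtain ⟨p, hp, q, hq, hpx, hxq, hpq⟩ :=
    exists_consecutive hi' hj' hxS (hij x hx).1 (hij x hx).2
  have e : D.Edge p q := (h'.2 p hp q hq (by omega)).2 (Or.inl hpq)
  have hp0 := hij' p hp
  have hq0 := hij' q hq
  have hpS : p ∈ S := by
    by_contra hpS
    obtain ⟨p', hp', q', hq', h1, h2, h3⟩ := exists_consecutive hi hx hpS hp0.1 hpx.le
    have := h3 x hx
    exact ((h.2 p' hp' q' hq' (by omega)).2 (Or.inl h3)).not_cross e h1 h2 (by omega)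
  have hqS : q ∈ S := by
    by_contra hqS
    obtain ⟨p', hp', q', hq', h1, h2, h3⟩ := exists_consecutive hx hj hqS hxq.le hq0.2
    have := h3 x hx
    exact e.not_cross ((h.2 p' hp' q' hq' (by omega)).2 (Or.inl h3)) (by omega) h1 h2
  rcases (h.2 p hpS q hqS (by omega)).1 e with hk | hk
  · exact hk x hx ⟨hpx, hxq⟩
  · have h1 := hk i hi
    have h2 := hk j hj
    obtain ⟨z, hz, hzi⟩ : ∃ z ∈ S', z ∉ ({i, j} : Finset (Fin n)) := by
      by_contra! hc
      have := Finset.card_le_card (show S' ⊆ {i, j} from hc)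
      have := Finset.card_le_two (a := i) (b := j)
      omega
    simp only [Finset.mem_insert, Finset.mem_singleton] at hzi
    have := hpq z hz
    have := hij' z hz
    omega

/-- A cell is determined by its first and last vertex. -/
theorem IsCell.eq_of_extremes {S S' : Finset (Fin n)} (h : D.IsCell S) (h' : D.IsCell S')
    {i j : Fin n} (hi : i ∈ S) (hj : j ∈ S) (hij : ∀ k ∈ S, i ≤ k ∧ k ≤ j)
    (hi' : i ∈ S') (hj' : j ∈ S') (hij' : ∀ k ∈ S', i ≤ k ∧ k ≤ j) : S = S' :=
  (h.subset_of_extremes h' hi hj hij hi' hj' hij').antisymm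
    (h'.subset_of_extremes h hi' hj' hij' hi hj hij)

theorem IsCell.exists_extremes {S : Finset (Fin n)} (h : D.IsCell S) :
    ∃ i ∈ S, ∃ j ∈ S, i.val + 1 < j.val ∧ D.Edge i j ∧ ∀ k ∈ S, i ≤ k ∧ k ≤ j := by
  have h3 := h.1
  have hne : S.Nonempty := Finset.card_pos.1 (by omega)
  have hb : ∀ k ∈ S, S.min' hne ≤ k ∧ k ≤ S.max' hne :=
    fun k hk => ⟨S.min'_le k hk, S.le_max' k hk⟩
  have hlt : (S.min' hne).val + 1 < (S.max' hne).val := by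
    have h4 := Finset.card_le_card
      (show S ⊆ Finset.Icc (S.min' hne) (S.max' hne) from fun k hk => Finset.mem_Icc.2 (hb k hk))
    rw [Fin.card_Icc] at h4
    omega
  exact ⟨_, S.min'_mem hne, _, S.max'_mem hne, hlt,
    ((isCell_iff.1 h).2 _ (S.min'_mem hne) _ (S.max'_mem hne) (by omega)).2 (Or.inr hb), hb⟩

theorem IsTriQuad.below (hD : D.IsTriQuad) {i j : Fin n} (h : D.Edge i j)
    (hij : i.val + 1 < j.val) :
    (∃ k, i < k ∧ k < j ∧ D.Edge i k ∧ D.Edge k j ∧ D.IsCell {i, k, j}) ∨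
    ∃ k l, i < k ∧ k < l ∧ l < j ∧ D.Edge i k ∧ D.Edge k l ∧ D.Edge l j ∧ ¬ D.Edge i l ∧
      ¬ D.Edge k j ∧ D.IsCell {i, k, l, j} := by
  obtain ⟨S, hS, hi, hj, hb, -⟩ := exists_cell_below h hij
  rcases hD S hS with hc | hc
  · obtain ⟨a, b, c, hab, hbc, rfl⟩ := exists_eq_triple hc
    have h1 := hb a (by simp)
    have h2 := hb c (by simp)
    simp only [Finset.mem_insert, Finset.mem_singleton] at hi hj
    obtain rfl : a = i := by omega
    obtain rfl : c = j := by omega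
    have := (isCell_triple hab hbc).1 hS
    exact Or.inl ⟨b, hab, hbc, this.1, this.2.1, hS⟩
  · obtain ⟨a, b, c, d, hab, hbc, hcd, rfl⟩ := exists_eq_quadruple hc
    have h1 := hb a (by simp)
    have h2 := hb d (by simp)
    simp only [Finset.mem_insert, Finset.mem_singleton] at hi hj
    obtain rfl : a = i := by omega
    obtain rfl : d = j := by omega
    have := (isCell_quadruple hab hbc hcd).1 hS
    exact Or.inr ⟨b, c, hab, hbc, hcd, this.1, this.2.1, this.2.2.1, this.2.2.2.2.1,
      this.2.2.2.2.2, hS⟩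

theorem IsTriangulation.below (hD : D.IsTriangulation) {i j : Fin n} (h : D.Edge i j)
    (hij : i.val + 1 < j.val) : ∃ k, i < k ∧ k < j ∧ D.Edge i k ∧ D.Edge k j := by
  obtain ⟨S, hS, hi, hj, hb, -⟩ := exists_cell_below h hij
  obtain ⟨a, b, c, hab, hbc, rfl⟩ := exists_eq_triple (hD S hS)
  have h1 := hb a (by simp)
  have h2 := hb c (by simp)
  simp only [Finset.mem_insert, Finset.mem_singleton] at hi hj
  obtain rfl : a = i := by omega
  obtain rfl : c = j := by omega
  have := (isCell_triple hab hbc).1 hS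
  exact ⟨b, hab, hbc, this.1, this.2.1⟩

/-- In a triangulation, each edge other than the one from the first to the last vertex also has a
triangle on its other side. -/
theorem IsTriangulation.above (hD : D.IsTriangulation) {x y : Fin n} (h : D.Edge x y)
    (hxy : 0 < x.val ∨ y.val + 1 < n) :
    ∃ w, (w < x ∧ D.Edge w x ∧ D.Edge w y) ∨ (y < w ∧ D.Edge x w ∧ D.Edge y w) := by
  classical
  have hlt := h.lt
  -- the shortest edge that strictly contains `(x, y)`
  obtain ⟨⟨a, b⟩, hab, hm⟩ := ((Finset.univ : Finset (Fin n × Fin n)).filter fun e =>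
    D.Edge e.1 e.2 ∧ e.1 ≤ x ∧ y ≤ e.2 ∧ ¬ (e.1 = x ∧ e.2 = y)).exists_min_image
      (fun e => e.2.val - e.1.val)
      ⟨(⟨0, by omega⟩, ⟨n - 1, by omega⟩), by
        simp only [Finset.mem_filter, Finset.mem_univ, true_and]
        refine ⟨D.edge_root (Fin.lt_def.2 (by simp only; omega)) rfl (by simp only; omega), ?_, ?_, ?_⟩
        · rw [Fin.le_def]; simp only; omega
        · rw [Fin.le_def]; simp only; omega
        · rw [Fin.ext_iff, Fin.ext_iff]; simp only; omega⟩
  simp only [Finset.mem_filter, Finset.mem_univ, true_and, and_imp, Prod.forall] at hab hm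
  obtain ⟨e, hax, hyb, hne⟩ := hab
  obtain ⟨S, hS, ha, hb, hbd, hin⟩ := exists_cell_below e (by omega)
  have hxS : x ∈ S := hin x (by omega) (by omega) fun c d hcd h1 h2 h3 h4 => by
    rcases le_or_gt y d with h5 | h5
    · have := hm c d hcd h3.le h5 (by omega)
      omega
    · exact (hcd.not_cross h h3 h4 h5).elim
  have hyS : y ∈ S := hin y (by omega) (by omega) fun c d hcd h1 h2 h3 h4 => by
    rcases le_or_gt c x with h5 | h5
    · have := hm c d hcd h5 h4.le (by omega)
      omega
    · exact (h.not_cross hcd h5 h3 h4).elim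
  obtain ⟨p, q, r, hpq, hqr, rfl⟩ := exists_eq_triple (hD S hS)
  obtain ⟨e1, e2, e3⟩ := (isCell_triple hpq hqr).1 hS
  have h1 := hbd p (by simp)
  have h2 := hbd r (by simp)
  simp only [Finset.mem_insert, Finset.mem_singleton] at ha hb hxS hyS
  obtain rfl : p = a := by omega
  obtain rfl : r = b := by omega
  rcases (by omega : (x = p ∧ y = q) ∨ (x = q ∧ y = r)) with ⟨rfl, rfl⟩ | ⟨rfl, rfl⟩
  · exact ⟨r, Or.inr ⟨hqr, e3, e2⟩⟩
  · exact ⟨p, Or.inl ⟨hpq, e1, e3⟩⟩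

theorem isTriangulation_of_below
    (h : ∀ i j, D.Edge i j → i.val + 1 < j.val → ∃ k, i < k ∧ k < j ∧ D.Edge i k ∧ D.Edge k j) :
    D.IsTriangulation := by
  intro S hS
  obtain ⟨i, hi, j, hj, hij, e, hb⟩ := hS.exists_extremes
  obtain ⟨k, hik, hkj, e1, e2⟩ := h i j e hij
  have hT : D.IsCell {i, k, j} := (isCell_triple hik hkj).2 ⟨e1, e2, e⟩
  rw [hS.eq_of_extremes hT hi hj hb (by simp) (by simp) (by simp; omega), card_triple hik hkj]

end Dissection

end Cells

/-! ### Weights of the diagonals -/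

section Weights

variable {n : ℕ} [NeZero n]

open Dissection

theorem sqrtTwoToReal_apply (z : Zsqrtd 2) :
    sqrtTwoToReal z = z.re + z.im * √2 := by
  simp [sqrtTwoToReal, Zsqrtd.toReal]

theorem sqrtTwoToReal_injective : Function.Injective sqrtTwoToReal :=
  Zsqrtd.toReal_injective _ fun m h => by
    have h1 : m ≤ 1 := by nlinarith
    have h2 : -1 ≤ m := by nlinarith
    interval_cases m <;> omega

theorem sqrtTwoToReal_sqrtd : sqrtTwoToReal Zsqrtd.sqrtd = √2 := by
  simp [sqrtTwoToReal_apply]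

theorem sqrtd_mul_self : (Zsqrtd.sqrtd : Zsqrtd 2) * Zsqrtd.sqrtd = 2 := by
  rw [Zsqrtd.ext_iff]; simp

/-- `F` gives each pair `x ≤ y` of vertices a weight so that the Ptolemy relation holds, the edges
of `D` have weight `1` and the diagonals of the quadrilaterals of `D` have weight `√2`. This is the
frieze from `D` in terms of the linear order of the vertices; `F x y` is irrelevant for `y < x`. -/
structure IsWeighting (D : Dissection n) (F : Fin n → Fin n → Zsqrtd 2) : Prop where
  diag : ∀ x, F x x = 0
  ptolemy : ∀ a b c d, a ≤ b → b ≤ c → c ≤ d →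
    F a c * F b d = F a b * F c d + F a d * F b c
  edge : ∀ x y, D.Edge x y → F x y = 1
  quad : ∀ a b c d, a < b → b < c → c < d → D.IsCell {a, b, c, d} →
    F a c = Zsqrtd.sqrtd ∧ F b d = Zsqrtd.sqrtd

namespace IsWeighting

variable {D : Dissection n} {F : Fin n → Fin n → Zsqrtd 2}

theorem triangle_left (hF : IsWeighting D F) {i k j x : Fin n} (h1 : D.Edge i k)
    (h3 : D.Edge k j) (h2 : D.Edge i j) (hx : i ≤ x) (hxk : x ≤ k) :
    F x j = F i x + F x k := by
  have := hF.ptolemy i x k j hx hxk h3.lt.le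
  rw [hF.edge _ _ h1, hF.edge _ _ h2, hF.edge _ _ h3] at this
  linear_combination this

theorem triangle_right (hF : IsWeighting D F) {i k j x : Fin n} (h1 : D.Edge i k)
    (h3 : D.Edge k j) (h2 : D.Edge i j) (hx : k ≤ x) (hxk : x ≤ j) :
    F i x = F k x + F x j := by
  have := hF.ptolemy i k x j h1.lt.le hx hxk
  rw [hF.edge _ _ h1, hF.edge _ _ h2, hF.edge _ _ h3] at this
  linear_combination this

section Quad

variable {i k l j x : Fin n}

theorem quad_left (hF : IsWeighting D F) (hik : i < k) (hkl : k < l) (hlj : l < j)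
    (h : D.IsCell {i, k, l, j}) (hx : i ≤ x) (hx' : x ≤ k) :
    F x j = Zsqrtd.sqrtd * F i x + F x k := by
  obtain ⟨h1, h2, h3, h4, -, -⟩ := (isCell_quadruple hik hkl hlj).1 h
  have := hF.ptolemy i x k j hx hx' (by omega)
  rw [hF.edge _ _ h1, (hF.quad _ _ _ _ hik hkl hlj h).2, hF.edge _ _ h4] at this
  linear_combination this

theorem quad_middle (hF : IsWeighting D F) (hik : i < k) (hkl : k < l) (hlj : l < j)
    (h : D.IsCell {i, k, l, j}) (hx : k ≤ x) (hx' : x ≤ l) :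
    F i x = Zsqrtd.sqrtd * F k x + F x l ∧ F x j = F k x + Zsqrtd.sqrtd * F x l := by
  obtain ⟨h1, h2, h3, h4, -, -⟩ := (isCell_quadruple hik hkl hlj).1 h
  obtain ⟨q1, q2⟩ := hF.quad _ _ _ _ hik hkl hlj h
  have e1 := hF.ptolemy i k x l hik.le hx hx'
  have e2 := hF.ptolemy k x l j hx hx' hlj.le
  rw [hF.edge _ _ h1, hF.edge _ _ h2, q1] at e1
  rw [hF.edge _ _ h2, hF.edge _ _ h3, q2] at e2
  exact ⟨by linear_combination e1, by linear_combination e2⟩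

theorem quad_right (hF : IsWeighting D F) (hik : i < k) (hkl : k < l) (hlj : l < j)
    (h : D.IsCell {i, k, l, j}) (hx : l ≤ x) (hx' : x ≤ j) :
    F i x = F l x + Zsqrtd.sqrtd * F x j := by
  obtain ⟨h1, h2, h3, h4, -, -⟩ := (isCell_quadruple hik hkl hlj).1 h
  have := hF.ptolemy i l x j (by omega) hx hx'
  rw [hF.edge _ _ h3, (hF.quad _ _ _ _ hik hkl hlj h).1, hF.edge _ _ h4] at this
  linear_combination this

end Quad

/-- If all weights within `[i, k]` and within `[k, j]` are positive, and so is the weight of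
`(i, j)`, then all weights within `[i, j]` are positive. -/
theorem pos_concat (hF : IsWeighting D F) {i k j : Fin n} (hik : i < k) (hkj : k < j)
    (h1 : ∀ x y, i ≤ x → x < y → y ≤ k → 0 < sqrtTwoToReal (F x y))
    (h2 : ∀ x y, k ≤ x → x < y → y ≤ j → 0 < sqrtTwoToReal (F x y))
    (h3 : 0 < sqrtTwoToReal (F i j)) :
    ∀ x y, i ≤ x → x < y → y ≤ j → 0 < sqrtTwoToReal (F x y) := by
  have hi : ∀ y, k < y → y ≤ j → 0 < sqrtTwoToReal (F i y) := by
    intro y hky hyj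
    rcases hyj.eq_or_lt with rfl | hyj
    · exact h3
    have e := congrArg sqrtTwoToReal (hF.ptolemy i k y j hik.le hky.le hyj.le)
    simp only [map_mul, map_add] at e
    have p1 := h2 k j le_rfl hkj le_rfl
    have p2 := h1 i k le_rfl hik le_rfl
    have p3 := h2 y j hky.le hyj le_rfl
    have p4 := h2 k y le_rfl hky hyj.le
    refine pos_of_mul_pos_left ?_ p1.le
    rw [e]
    positivity
  intro x y hix hxy hyj
  rcases le_or_gt y k with hyk | hky
  · exact h1 x y hix hxy hyk
  rcases le_or_gt k x with hkx | hxk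
  · exact h2 x y hkx hxy hyj
  rcases hix.eq_or_lt with rfl | hix
  · exact hi y hky hyj
  have e := congrArg sqrtTwoToReal (hF.ptolemy i x k y hix.le hxk.le hky.le)
  simp only [map_mul, map_add] at e
  have p1 := h1 i k le_rfl hik le_rfl
  have p2 := h1 i x le_rfl hix hxk.le
  have p3 := h2 k y le_rfl hky hyj
  have p4 := hi y hky hyj
  have p5 := h1 x k hix.le hxk le_rfl
  refine pos_of_mul_pos_right ?_ p1.le
  rw [e]
  positivity

theorem pos_of_edge (hF : IsWeighting D F) (hD : D.IsTriQuad) (i j : Fin n) (e : D.Edge i j) :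
    ∀ x y, i ≤ x → x < y → y ≤ j → 0 < sqrtTwoToReal (F x y) := by
  induction hd : j.val - i.val using Nat.strong_induction_on generalizing i j with
  | _ d ih =>
    have h3 : 0 < sqrtTwoToReal (F i j) := by rw [hF.edge _ _ e]; simp
    have hlt := e.lt
    rcases (by omega : j.val = i.val + 1 ∨ i.val + 1 < j.val) with hij | hij
    · intro x y h1 h2 h4
      rw [show x = i by omega, show y = j by omega]
      exact h3
    · rcases hD.below e hij with ⟨k, hik, hkj, e1, e2, -⟩ |
        ⟨k, l, hik, hkl, hlj, e1, e2, e4, -, -, hC⟩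
      · exact hF.pos_concat hik hkj (ih _ (by omega) i k e1 rfl) (ih _ (by omega) k j e2 rfl) h3
      · refine hF.pos_concat (by omega) hlj ?_ (ih _ (by omega) l j e4 rfl) h3
        refine hF.pos_concat hik hkl (ih _ (by omega) i k e1 rfl) (ih _ (by omega) k l e2 rfl) ?_
        rw [(hF.quad _ _ _ _ hik hkl hlj hC).1, sqrtTwoToReal_sqrtd]
        positivity

theorem pos (hF : IsWeighting D F) (hD : D.IsTriQuad) {x y : Fin n} (h : x < y) :
    0 < sqrtTwoToReal (F x y) := by
  refine hF.pos_of_edge hD ⟨0, by omega⟩ ⟨n - 1, by omega⟩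
    (D.edge_root (Fin.lt_def.2 ?_) rfl ?_) x y (Fin.le_def.2 ?_) h (Fin.le_def.2 ?_) <;>
  simp only <;> omega

theorem eq_on_edge (hF : IsWeighting D F) {G : Fin n → Fin n → Zsqrtd 2} (hG : IsWeighting D G)
    (hD : D.IsTriQuad) (i j : Fin n) (e : D.Edge i j) :
    ∀ x, i ≤ x → x ≤ j → F i x = G i x ∧ F x j = G x j := by
  induction hd : j.val - i.val using Nat.strong_induction_on generalizing i j with
  | _ d ih =>
    have hlt := e.lt
    intro x hix hxj
    rcases (by omega : x = i ∨ x = j ∨ (i < x ∧ x < j)) with rfl | rfl | ⟨hix', hxj'⟩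
    · rw [hF.diag, hG.diag, hF.edge _ _ e, hG.edge _ _ e]
      simp
    · rw [hF.diag, hG.diag, hF.edge _ _ e, hG.edge _ _ e]
      simp
    rcases hD.below e (by omega) with ⟨k, hik, hkj, e1, e2, -⟩ |
        ⟨k, l, hik, hkl, hlj, e1, e2, e4, -, -, hC⟩
    · rcases le_total x k with hx | hx
      · obtain ⟨a1, a2⟩ := ih _ (by omega) i k e1 rfl x hix hx
        rw [hF.triangle_left e1 e2 e hix hx, hG.triangle_left e1 e2 e hix hx, a1, a2]
        simp
      · obtain ⟨a1, a2⟩ := ih _ (by omega) k j e2 rfl x hx hxj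
        rw [hF.triangle_right e1 e2 e hx hxj, hG.triangle_right e1 e2 e hx hxj, a1, a2]
        simp
    · rcases le_total x k with hx | hx
      · obtain ⟨a1, a2⟩ := ih _ (by omega) i k e1 rfl x hix hx
        rw [hF.quad_left hik hkl hlj hC hix hx, hG.quad_left hik hkl hlj hC hix hx, a1, a2]
        simp
      rcases le_total x l with hx' | hx'
      · obtain ⟨a1, a2⟩ := ih _ (by omega) k l e2 rfl x hx hx'
        obtain ⟨b1, b2⟩ := hF.quad_middle hik hkl hlj hC hx hx'
        obtain ⟨c1, c2⟩ := hG.quad_middle hik hkl hlj hC hx hx'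
        rw [b1, b2, c1, c2, a1, a2]
        simp
      · obtain ⟨a1, a2⟩ := ih _ (by omega) l j e4 rfl x hx' hxj
        rw [hF.quad_right hik hkl hlj hC hx' hxj, hG.quad_right hik hkl hlj hC hx' hxj, a1, a2]
        simp

theorem unique (hF : IsWeighting D F) {G : Fin n → Fin n → Zsqrtd 2} (hG : IsWeighting D G)
    (hD : D.IsTriQuad) {x y : Fin n} (hxy : x < y) : F x y = G x y := by
  obtain ⟨r, hr⟩ : ∃ r : Fin n, r.val = 0 := ⟨⟨0, by omega⟩, rfl⟩
  obtain ⟨s, hs⟩ : ∃ s : Fin n, s.val + 1 = n := ⟨⟨n - 1, by omega⟩, by simp only; omega⟩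
  have e := D.edge_root (x := r) (y := s) (by omega) hr hs
  have h := hF.eq_on_edge hG hD r s e
  have hF' := hF.ptolemy r x y s (by omega) hxy.le (by omega)
  have hG' := hG.ptolemy r x y s (by omega) hxy.le (by omega)
  obtain ⟨a1, a2⟩ := h x (by omega) (by omega)
  obtain ⟨b1, b2⟩ := h y (by omega) (by omega)
  rw [hF.edge _ _ e, a1, a2, b1, b2] at hF'
  rw [hG.edge _ _ e] at hG'
  linear_combination hG' - hF'

end IsWeighting

/-- The determinant of two vectors in the plane. -/
def det₂ (u v : Zsqrtd 2 × Zsqrtd 2) : Zsqrtd 2 := u.1 * v.2 - u.2 * v.1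

theorem edge_cases_triangle {D : Dissection n} {i k j x y : Fin n} (h1 : D.Edge i k)
    (h2 : D.Edge k j) (h : D.Edge x y) (hx : i ≤ x) (hy : y ≤ j) :
    y ≤ k ∨ k ≤ x ∨ (x = i ∧ y = j) := by
  by_contra! hc
  rcases (by omega : i < x ∨ y < j) with h' | h'
  · exact h1.not_cross h h' (by omega) (by omega)
  · exact h.not_cross h2 (by omega) (by omega) h'

theorem edge_cases_quad {D : Dissection n} {i k l j x y : Fin n} (h1 : D.Edge i k)
    (h2 : D.Edge k l) (h3 : D.Edge l j) (h4 : ¬ D.Edge i l) (h5 : ¬ D.Edge k j) (h : D.Edge x y)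
    (hx : i ≤ x) (hy : y ≤ j) :
    y ≤ k ∨ (k ≤ x ∧ y ≤ l) ∨ l ≤ x ∨ (x = i ∧ y = j) := by
  by_contra! hc
  have hkl := h2.lt
  rcases (by omega : i < x ∧ x < k ∨ x = i ∨ k ≤ x) with h' | h' | h'
  · exact h1.not_cross h h'.1 h'.2 (by omega)
  · subst h'
    rcases (by omega : y < l ∨ y = l ∨ l < y) with h'' | rfl | h''
    · exact h.not_cross h2 h1.lt (by omega) h''
    · exact h4 h
    · exact h.not_cross h3 (by omega) h'' (by omega)
  · rcases (by omega : k < x ∧ x < l ∨ x = k) with h'' | rfl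
    · exact h2.not_cross h h''.1 h''.2 (by omega)
    · rcases (by omega : y < j ∨ y = j) with h'' | rfl
      · exact h.not_cross h3 (by omega) (by omega) h''
      · exact h5 h

/-- Every dissection into triangles and quadrilaterals is realized by vectors in the plane: the
determinants along edges are `1` and those along the diagonals of quadrilaterals are `√2`. A
triangle below the edge from `a` to `b` gets the third vertex `a + b`, a quadrilateral the further
vertices `√2 a + b` and `a + √2 b`. -/
theorem exists_vectors {D : Dissection n} (hD : D.IsTriQuad) (i j : Fin n) (e : D.Edge i j)
    (a b : Zsqrtd 2 × Zsqrtd 2) (hab : det₂ a b = 1) :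
    ∃ v : Fin n → Zsqrtd 2 × Zsqrtd 2, v i = a ∧ v j = b ∧
      (∀ x y, i ≤ x → y ≤ j → D.Edge x y → det₂ (v x) (v y) = 1) ∧
      ∀ x y z w, x < y → y < z → z < w → i ≤ x → w ≤ j → D.IsCell {x, y, z, w} →
        det₂ (v x) (v z) = Zsqrtd.sqrtd ∧ det₂ (v y) (v w) = Zsqrtd.sqrtd := by
  induction hd : j.val - i.val using Nat.strong_induction_on generalizing i j a b with
  | _ d ih =>
    have hlt := e.lt
    rcases (by omega : j.val = i.val + 1 ∨ i.val + 1 < j.val) with hij | hij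
    · refine ⟨fun x => if x = i then a else b, by simp, by simp [hlt.ne'], ?_, ?_⟩
      · intro x y h1 h2 h3
        have := h3.lt
        rw [show x = i by omega, show y = j by omega]
        simp [hlt.ne', hab]
      · intro x y z w _ _ _ _ _
        omega
    rcases hD.below e hij with ⟨k, hik, hkj, e1, e2, hC⟩ |
        ⟨k, l, hik, hkl, hlj, e1, e2, e4, ne1, ne2, hC⟩
    · obtain ⟨v, vi, vk, ve, vq⟩ := ih _ (by omega) i k e1 a (a + b)
        (by simp only [det₂, Prod.fst_add, Prod.snd_add] at hab ⊢; linear_combination hab) rfl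
      obtain ⟨u, uk, uj, ue, uq⟩ := ih _ (by omega) k j e2 (a + b) b
        (by simp only [det₂, Prod.fst_add, Prod.snd_add] at hab ⊢; linear_combination hab) rfl
      let V : Fin n → Zsqrtd 2 × Zsqrtd 2 := fun x => if x ≤ k then v x else u x
      have hv : ∀ x, x ≤ k → V x = v x := fun x hx => if_pos hx
      have hu : ∀ x, k ≤ x → V x = u x := fun x hx => by
        rcases hx.eq_or_lt with rfl | hx
        · rw [hv k le_rfl, vk, uk]
        · exact if_neg (by omega)
      refine ⟨V, by rw [hv i hik.le, vi], by rw [hu j hkj.le, uj], ?_, ?_⟩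
      · intro x y hx hy hxy
        have := hxy.lt
        rcases edge_cases_triangle e1 e2 hxy hx hy with h | h | ⟨rfl, rfl⟩
        · rw [hv x (by omega), hv y h]
          exact ve x y hx h hxy
        · rw [hu x h, hu y (by omega)]
          exact ue x y h hy hxy
        · rw [hv x hik.le, hu y hkj.le, vi, uj, hab]
      · intro x y z w hxy hyz hzw hx hw hQ
        have exw := ((isCell_quadruple hxy hyz hzw).1 hQ).2.2.2.1
        rcases edge_cases_triangle e1 e2 exw hx hw with h | h | ⟨rfl, rfl⟩
        · rw [hv x (by omega), hv y (by omega), hv z (by omega), hv w h]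
          exact vq x y z w hxy hyz hzw hx h hQ
        · rw [hu x h, hu y (by omega), hu z (by omega), hu w (by omega)]
          exact uq x y z w hxy hyz hzw h hw hQ
        · have := hQ.eq_of_extremes hC (i := x) (j := w) (by simp) (by simp) (by simp; omega)
            (by simp) (by simp) (by simp; omega)
          have h1 := card_quadruple hxy hyz hzw
          rw [this, card_triple hik hkj] at h1
          omega
    · let s : Zsqrtd 2 := Zsqrtd.sqrtd
      have hs : s * s = 2 := sqrtd_mul_self
      let c : Zsqrtd 2 × Zsqrtd 2 := (s * a.1 + b.1, s * a.2 + b.2)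
      let d : Zsqrtd 2 × Zsqrtd 2 := (a.1 + s * b.1, a.2 + s * b.2)
      have hac : det₂ a c = 1 := by simp only [det₂, c] at hab ⊢; linear_combination hab
      have hcd : det₂ c d = 1 := by
        simp only [det₂, c, d] at hab ⊢
        linear_combination (s * s - 1) * hab + hs
      have hdb : det₂ d b = 1 := by simp only [det₂, d] at hab ⊢; linear_combination hab
      have had : det₂ a d = s := by simp only [det₂, d] at hab ⊢; linear_combination s * hab
      have hcb : det₂ c b = s := by simp only [det₂, c] at hab ⊢; linear_combination s * hab
      obtain ⟨v, vi, vk, ve, vq⟩ := ih _ (by omega) i k e1 a c hac rfl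
      obtain ⟨t, tk, tl, te, tq⟩ := ih _ (by omega) k l e2 c d hcd rfl
      obtain ⟨u, ul, uj, ue, uq⟩ := ih _ (by omega) l j e4 d b hdb rfl
      let V : Fin n → Zsqrtd 2 × Zsqrtd 2 :=
        fun x => if x ≤ k then v x else if x ≤ l then t x else u x
      have hv : ∀ x, x ≤ k → V x = v x := fun x hx => if_pos hx
      have ht : ∀ x, k ≤ x → x ≤ l → V x = t x := fun x hx hx' => by
        rcases hx.eq_or_lt with rfl | hx
        · rw [hv k le_rfl, vk, tk]
        · simp only [V]
          rw [if_neg (by omega), if_pos hx']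
      have hu : ∀ x, l ≤ x → V x = u x := fun x hx => by
        rcases hx.eq_or_lt with rfl | hx
        · rw [ht l hkl.le le_rfl, tl, ul]
        · simp only [V]
          rw [if_neg (by omega), if_neg (by omega)]
      refine ⟨V, by rw [hv i hik.le, vi], by rw [hu j hlj.le, uj], ?_, ?_⟩
      · intro x y hx hy hxy
        have := hxy.lt
        rcases edge_cases_quad e1 e2 e4 ne1 ne2 hxy hx hy with h | h | h | ⟨rfl, rfl⟩
        · rw [hv x (by omega), hv y h]
          exact ve x y hx h hxy
        · rw [ht x h.1 (by omega), ht y (by omega) h.2]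
          exact te x y h.1 h.2 hxy
        · rw [hu x h, hu y (by omega)]
          exact ue x y h hy hxy
        · rw [hv x hik.le, hu y hlj.le, vi, uj, hab]
      · intro x y z w hxy hyz hzw hx hw hQ
        have exw := ((isCell_quadruple hxy hyz hzw).1 hQ).2.2.2.1
        rcases edge_cases_quad e1 e2 e4 ne1 ne2 exw hx hw with h | h | h | ⟨rfl, rfl⟩
        · rw [hv x (by omega), hv y (by omega), hv z (by omega), hv w h]
          exact vq x y z w hxy hyz hzw hx h hQ
        · rw [ht x h.1 (by omega), ht y (by omega) (by omega), ht z (by omega) (by omega),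
            ht w (by omega) h.2]
          exact tq x y z w hxy hyz hzw h.1 h.2 hQ
        · rw [hu x h, hu y (by omega), hu z (by omega), hu w (by omega)]
          exact uq x y z w hxy hyz hzw h hw hQ
        · have h1 := hQ.eq_of_extremes hC (i := x) (j := w) (by simp) (by simp)
            (by simp; omega) (by simp) (by simp) (by simp; omega)
          have hy : y ∈ ({x, k, l, w} : Finset (Fin n)) := by rw [← h1]; simp
          have hz : z ∈ ({x, k, l, w} : Finset (Fin n)) := by rw [← h1]; simp
          simp only [Finset.mem_insert, Finset.mem_singleton] at hy hz
          obtain rfl : y = k := by omega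
          obtain rfl : z = l := by omega
          rw [hv x hik.le, vi, hu z le_rfl, ul, hv y le_rfl, vk, hu w hlj.le, uj]
          exact ⟨had, hcb⟩

theorem exists_isWeighting (hn : 3 ≤ n) {D : Dissection n} (hD : D.IsTriQuad) :
    ∃ F, IsWeighting D F := by
  obtain ⟨r, hr⟩ : ∃ r : Fin n, r.val = 0 := ⟨⟨0, by omega⟩, rfl⟩
  obtain ⟨s, hs⟩ : ∃ s : Fin n, s.val + 1 = n := ⟨⟨n - 1, by omega⟩, by simp only; omega⟩
  obtain ⟨v, -, -, ve, vq⟩ := exists_vectors hD r s (D.edge_root (by omega) hr hs) (1, 0) (0, 1)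
    (by simp [det₂])
  refine ⟨fun x y => det₂ (v x) (v y), fun x => ?_, fun a b c d _ _ _ => ?_, fun x y h => ?_,
    fun a b c d h1 h2 h3 => ?_⟩
  · simp only [det₂]; ring
  · simp only [det₂]; ring
  · exact ve x y (by omega) (by omega) h
  · exact vq a b c d h1 h2 h3 (by omega) (by omega)

end Weights

/-! ### The frieze from a dissection exists and is unique -/

section Frieze

variable {n : ℕ} [NeZero n]

open Dissection

theorem euclideanFrieze_self (p a : ℕ) : euclideanFrieze p a a = 0 := by
  simp [euclideanFrieze]

theorem euclideanFrieze_comm (p a b : ℕ) : euclideanFrieze p a b = euclideanFrieze p b a := by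
  rw [euclideanFrieze, euclideanFrieze, abs_sub_comm]

theorem euclideanFrieze_eq (p a k : ℕ) :
    euclideanFrieze p a (a + k) =
      (Polynomial.Chebyshev.S ℝ ((k : ℤ) - 1)).eval (2 * Real.cos (Real.pi / p)) := by
  simp [euclideanFrieze]

theorem euclideanFrieze_one (p a : ℕ) : euclideanFrieze p a (a + 1) = 1 := by
  simp [euclideanFrieze_eq]

theorem euclideanFrieze_two (p a : ℕ) :
    euclideanFrieze p a (a + 2) = 2 * Real.cos (Real.pi / p) := by
  rw [euclideanFrieze_eq]
  norm_num

theorem euclideanFrieze_three (p a : ℕ) :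
    euclideanFrieze p a (a + 3) = (2 * Real.cos (Real.pi / p)) ^ 2 - 1 := by
  rw [euclideanFrieze_eq]
  norm_num [Polynomial.Chebyshev.S_two]

omit [NeZero n] in
open Classical in
/-- In a triangle or quadrilateral, the Euclidean frieze is `1` on the sides and `√2` on the
diagonals. -/
theorem euclideanFrieze_cell {S : Finset (Fin n)} (hS : S.card = 3 ∨ S.card = 4) {x y : Fin n}
    (hx : x ∈ S) (hy : y ∈ S) (hxy : x < y) :
    euclideanFrieze S.card (position S x) (position S y) =
      sqrtTwoToReal (if IsSide S s(x, y) then 1 else Zsqrtd.sqrtd) := by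
  have c3 : 2 * Real.cos (Real.pi / (3 : ℕ)) = 1 := by norm_num
  have c4 : 2 * Real.cos (Real.pi / (4 : ℕ)) = √2 := by
    norm_num
    ring
  rcases hS with h | h
  · obtain ⟨a, b, c, hab, hbc, rfl⟩ := exists_eq_triple h
    have pa : position {a, b, c} a = 0 := by
      simp [position, Finset.filter_insert, Finset.filter_singleton, hab.not_gt,
        (hab.trans hbc).not_gt]
    have pb : position {a, b, c} b = 0 + 1 := by
      simp [position, Finset.filter_insert, Finset.filter_singleton, hab, hbc.not_gt]
    have pc : position {a, b, c} c = 0 + 2 := by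
      simp [position, Finset.filter_insert, Finset.filter_singleton, hbc, hab.trans hbc, hab.ne]
    rw [h]
    have hs : ∀ k ∈ ({a, b, c} : Finset (Fin n)), k = a ∨ k = b ∨ k = c := by simp
    rcases hs x hx with rfl | rfl | rfl <;> rcases hs y hy with rfl | rfl | rfl <;> first
      | omega
      | (rw [if_pos]
         · simp only [pa, pb, pc, euclideanFrieze_one, euclideanFrieze_two, c3, map_one]
         · rw [isSide_iff hxy]
           simp only [Finset.mem_insert, Finset.mem_singleton, forall_eq_or_imp, forall_eq]
           grind)
  · obtain ⟨a, b, c, d, hab, hbc, hcd, rfl⟩ := exists_eq_quadruple h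
    have hac := hab.trans hbc
    have hbd := hbc.trans hcd
    have had := hac.trans hcd
    have pa : position {a, b, c, d} a = 0 := by
      simp [position, Finset.filter_insert, Finset.filter_singleton, hab.not_gt, hac.not_gt,
        had.not_gt]
    have pb : position {a, b, c, d} b = 0 + 1 := by
      simp [position, Finset.filter_insert, Finset.filter_singleton, hab, hbc.not_gt, hbd.not_gt]
    have pc : position {a, b, c, d} c = 0 + 2 := by
      simp [position, Finset.filter_insert, Finset.filter_singleton, hbc, hac, hab.ne,
        hcd.not_gt]
    have pd : position {a, b, c, d} d = 0 + 3 := by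
      have : ({a, b, c, d} : Finset (Fin n)).filter (· < d) = {a, b, c} := by
        simp [Finset.filter_insert, Finset.filter_singleton, hcd, hbd, had]
      rw [position, this, card_triple hab hbc]
    rw [h]
    have hs : ∀ k ∈ ({a, b, c, d} : Finset (Fin n)), k = a ∨ k = b ∨ k = c ∨ k = d := by simp
    have e13 : euclideanFrieze 4 (0 + 1) (0 + 3) = √2 := (euclideanFrieze_two 4 1).trans c4
    have e02 : euclideanFrieze 4 0 (0 + 2) = √2 := (euclideanFrieze_two 4 0).trans c4
    have e03 : euclideanFrieze 4 0 (0 + 3) = 1 := by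
      rw [euclideanFrieze_three, c4, Real.sq_sqrt (by norm_num)]
      norm_num
    rcases hs x hx with rfl | rfl | rfl | rfl <;> rcases hs y hy with rfl | rfl | rfl | rfl <;>
    first
      | omega
      | (rw [if_pos]
         · simp only [pa, pb, pc, pd, euclideanFrieze_one, e03, map_one]
         · rw [isSide_iff hxy]
           simp only [Finset.mem_insert, Finset.mem_singleton, forall_eq_or_imp, forall_eq]
           grind)
      | (rw [if_neg]
         · simp only [pa, pb, pc, pd, e02, e13, sqrtTwoToReal_sqrtd]
         · rw [isSide_iff hxy]
           simp only [Finset.mem_insert, Finset.mem_singleton, forall_eq_or_imp, forall_eq]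
           grind)

open Classical in
/-- In each cell of `D` the sides have weight `1` and the diagonals have weight `√2`. Unlike the
vertex labels in the Euclidean frieze, this does not depend on where one starts counting. -/
def HasCellWeights (D : Dissection n) (f : Fin n → Fin n → Zsqrtd 2) : Prop :=
  ∀ S, D.IsCell S → ∀ x ∈ S, ∀ y ∈ S, x ≠ y →
    f x y = if IsSide S s(x, y) then 1 else Zsqrtd.sqrtd

theorem isFriezeFromDissection_iff {D : Dissection n} (hD : D.IsTriQuad)
    {f : Fin n → Fin n → Zsqrtd 2} :
    IsFriezeFromDissection D f ↔ IsFrieze f ∧ HasCellWeights D f := by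
  classical
  refine and_congr_right fun hf => forall_congr' fun S => forall_congr' fun hS => ?_
  constructor
  · intro h x hx y hy hxy
    apply sqrtTwoToReal_injective
    rcases lt_or_gt_of_ne hxy with hlt | hlt
    · rw [h x hx y hy, euclideanFrieze_cell (hD S hS) hx hy hlt]
    · rw [hf.symm, h y hy x hx, euclideanFrieze_cell (hD S hS) hy hx hlt, Sym2.eq_swap]
  · intro h x hx y hy
    rcases lt_trichotomy x y with hlt | rfl | hlt
    · rw [h x hx y hy hlt.ne, euclideanFrieze_cell (hD S hS) hx hy hlt]
    · rw [(hf.eq_zero_iff x x).2 rfl, euclideanFrieze_self, map_zero]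
    · rw [hf.symm, h y hy x hx hlt.ne, euclideanFrieze_comm,
        euclideanFrieze_cell (hD S hS) hy hx hlt]

theorem IsFrieze.isWeighting {D : Dissection n} {f : Fin n → Fin n → Zsqrtd 2} (hf : IsFrieze f)
    (h : HasCellWeights D f) : IsWeighting D f where
  diag x := (hf.eq_zero_iff x x).2 rfl
  ptolemy a b c d hab hbc hcd := by
    have h0 : ∀ x, f x x = 0 := fun x => (hf.eq_zero_iff x x).2 rfl
    rcases hab.eq_or_lt with rfl | hab
    · rw [h0]; ring
    rcases hbc.eq_or_lt with rfl | hbc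
    · rw [h0]; ring
    rcases hcd.eq_or_lt with rfl | hcd
    · rw [h0]; ring
    have := hf.ptolemy a c b d (Or.inl ⟨by rw [sbtw_iff]; omega, by rw [sbtw_iff]; omega⟩)
    rw [hf.symm c b] at this
    linear_combination this
  edge x y e := by
    have hlt := e.lt
    by_cases hb : IsBoundary s(x, y)
    · obtain ⟨i, hi⟩ := hb
      rcases Sym2.eq_iff.1 hi with ⟨rfl, rfl⟩ | ⟨rfl, rfl⟩
      · exact hf.next _
      · rw [hf.symm]
        exact hf.next _
    · rw [isBoundary_iff hlt] at hb
      obtain ⟨S, hS, hx, hy, hxy, -⟩ := exists_cell_below e (by omega)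
      rw [h S hS x hx y hy hlt.ne, if_pos]
      exact (isSide_iff hlt).2 ⟨hx, hy, Or.inr hxy⟩
  quad a b c d hab hbc hcd hS := by
    constructor
    · rw [h _ hS a (by simp) c (by simp) (by omega), if_neg]
      rw [isSide_iff (by omega)]
      simp only [Finset.mem_insert, Finset.mem_singleton, forall_eq_or_imp, forall_eq]
      omega
    · rw [h _ hS b (by simp) d (by simp) (by omega), if_neg]
      rw [isSide_iff (by omega)]
      simp only [Finset.mem_insert, Finset.mem_singleton, forall_eq_or_imp, forall_eq]
      omega

/-- A weighting, made symmetric, is a frieze. -/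
theorem IsWeighting.exists_isFrieze (hn : 3 ≤ n) {D : Dissection n} (hD : D.IsTriQuad)
    {F : Fin n → Fin n → Zsqrtd 2} (hF : IsWeighting D F) :
    ∃ f : Fin n → Fin n → Zsqrtd 2, IsFrieze f ∧ HasCellWeights D f := by
  classical
  let f : Fin n → Fin n → Zsqrtd 2 := fun x y => if x ≤ y then F x y else F y x
  have f1 : ∀ x y, x ≤ y → f x y = F x y := fun x y h => if_pos h
  have fs : ∀ x y, f x y = f y x := by
    intro x y
    simp only [f]
    rcases lt_trichotomy x y with h | rfl | h
    · rw [if_pos h.le, if_neg (by omega)]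
    · rfl
    · rw [if_pos h.le, if_neg (by omega)]
  clear_value f
  have fp : ∀ a b c d, a < b → b < c → c < d →
      f a c * f b d = f a b * f c d + f a d * f b c := by
    intro a b c d hab hbc hcd
    have := hF.ptolemy a b c d hab.le hbc.le hcd.le
    rwa [← f1 a c (by omega), ← f1 b d (by omega), ← f1 a b (by omega), ← f1 c d (by omega),
      ← f1 a d (by omega), ← f1 b c (by omega)] at this
  have fb : ∀ x y, x ≠ y → IsBoundary s(x, y) → f x y = 1 := by
    intro x y hxy hb
    rcases lt_or_gt_of_ne hxy with h | h
    · rw [f1 x y h.le]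
      exact hF.edge _ _ ⟨h, Or.inl hb⟩
    · rw [fs, f1 y x h.le]
      exact hF.edge _ _ ⟨h, Or.inl (Sym2.eq_swap ▸ hb)⟩
  have hne : ∀ i : Fin n, i + 1 ≠ i := by
    intro i h
    have h1 : (1 : Fin n) = 0 := by simpa using h
    have h2 := congrArg Fin.val h1
    rw [Fin.val_one', Nat.mod_eq_of_lt (by omega), Fin.val_zero] at h2
    omega
  refine ⟨f, ⟨?_, ?_, ?_, fs, ?_⟩, ?_⟩
  · intro x y
    constructor
    · intro h
      by_contra hxy
      rcases lt_or_gt_of_ne hxy with hlt | hlt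
      · have := hF.pos hD hlt
        rw [← f1 x y hlt.le, h, map_zero] at this
        exact lt_irrefl _ this
      · have := hF.pos hD hlt
        rw [← f1 y x hlt.le, fs, h, map_zero] at this
        exact lt_irrefl _ this
    · rintro rfl
      rw [f1 x x le_rfl, hF.diag]
  · exact fun i => fb _ _ (hne i).symm ⟨i, rfl⟩
  · intro i
    refine fb _ _ (fun h => hne (i - 1) ?_) ⟨i - 1, by rw [sub_add_cancel, Sym2.eq_swap]⟩
    rw [sub_add_cancel]
    exact h
  · have go : ∀ i j k l, sbtw i k j → sbtw j l i →
        f i j * f k l = f i l * f j k + f i k * f j l := by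
      intro i j k l h h'
      rw [sbtw_iff] at h h'
      rcases h with h | h | h <;> rcases h' with h' | h' | h' <;> first
        | (exfalso; omega)
        | (have := fp i k j l (by omega) (by omega) (by omega)
           simp only [fs k j] at this
           linear_combination this)
        | (have := fp k j l i (by omega) (by omega) (by omega)
           simp only [fs k j, fs l i, fs k i, fs j i] at this
           linear_combination this)
        | (have := fp j l i k (by omega) (by omega) (by omega)
           simp only [fs l i, fs j i, fs l k] at this
           linear_combination this)
        | (have := fp l i k j (by omega) (by omega) (by omega)
           simp only [fs l k, fs l i, fs k j, fs l j] at this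
           linear_combination this)
    rintro i j k l (⟨h, h'⟩ | ⟨h, h'⟩)
    · exact go i j k l h h'
    · have := go i j l k h h'
      rw [fs l k] at this
      linear_combination this
  · intro S hS x hx y hy hxy
    have key : ∀ x ∈ S, ∀ y ∈ S, x < y →
        f x y = if IsSide S s(x, y) then 1 else Zsqrtd.sqrtd := by
      intro x hx y hy hlt
      rw [f1 x y hlt.le]
      have hiff := ((isCell_iff.1 hS).2 x hx y hy hlt).trans
        (show _ ↔ IsSide S s(x, y) by rw [isSide_iff hlt]; tauto)
      split_ifs with h
      · exact hF.edge _ _ (hiff.2 h)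
      · have he : ¬ D.Edge x y := fun e => h (hiff.1 e)
        rcases hD S hS with hc | hc
        · obtain ⟨a, b, c, hab, hbc, rfl⟩ := exists_eq_triple hc
          obtain ⟨e1, e2, e3⟩ := (isCell_triple hab hbc).1 hS
          simp only [Finset.mem_insert, Finset.mem_singleton] at hx hy
          rcases hx with rfl | rfl | rfl <;> rcases hy with rfl | rfl | rfl <;> first
            | omega
            | exact absurd (by assumption) he
        · obtain ⟨a, b, c, d, hab, hbc, hcd, rfl⟩ := exists_eq_quadruple hc
          obtain ⟨e1, e2, e3, e4, -⟩ := (isCell_quadruple hab hbc hcd).1 hS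
          obtain ⟨q1, q2⟩ := hF.quad _ _ _ _ hab hbc hcd hS
          simp only [Finset.mem_insert, Finset.mem_singleton] at hx hy
          rcases hx with rfl | rfl | rfl | rfl <;> rcases hy with rfl | rfl | rfl | rfl <;> first
            | omega
            | exact absurd (by assumption) he
    rcases lt_or_gt_of_ne hxy with hlt | hlt
    · exact key x hx y hy hlt
    · rw [fs, key y hy x hx hlt, Sym2.eq_swap]

theorem existsUnique_isFriezeFromDissection (hn : 3 ≤ n) {D : Dissection n} (hD : D.IsTriQuad) :
    ∃! f : Fin n → Fin n → Zsqrtd 2, IsFriezeFromDissection D f := by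
  obtain ⟨F, hF⟩ := exists_isWeighting hn hD
  obtain ⟨f, hf, hfc⟩ := hF.exists_isFrieze hn hD
  refine ⟨f, (isFriezeFromDissection_iff hD).2 ⟨hf, hfc⟩, fun g hg => ?_⟩
  obtain ⟨hg, hgc⟩ := (isFriezeFromDissection_iff hD).1 hg
  have key : ∀ x y, x < y → g x y = f x y := fun x y h =>
    (hg.isWeighting hgc).unique (hf.isWeighting hfc) hD h
  funext x y
  rcases lt_trichotomy x y with h | rfl | h
  · exact key x y h
  · rw [(hg.eq_zero_iff x x).2 rfl, (hf.eq_zero_iff x x).2 rfl]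
  · rw [hg.symm, hf.symm, key y x h]

end Frieze

/-! ### Rotating the polygon -/

section Rotation

variable {n : ℕ} [NeZero n]

omit [NeZero n] in
theorem sbtw_add_right_iff (i j k r : Fin n) : sbtw (i + r) (j + r) (k + r) ↔ sbtw i j k := by
  simp only [sbtw_iff, Fin.lt_def, Fin.val_add_eq_ite]
  have := i.isLt
  have := j.isLt
  have := k.isLt
  have := r.isLt
  split_ifs <;> omega

theorem exists_eq_add_right (r i : Fin n) : ∃ j, i = j + r := ⟨i - r, by simp⟩

/-- The set `S` of vertices, rotated by `r`. -/
def rotateSet (r : Fin n) (S : Finset (Fin n)) : Finset (Fin n) :=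
  S.map (Equiv.addRight r).toEmbedding

theorem add_mem_rotateSet {r i : Fin n} {S : Finset (Fin n)} : i + r ∈ rotateSet r S ↔ i ∈ S := by
  simp [rotateSet]

theorem forall_mem_rotateSet {r : Fin n} {S : Finset (Fin n)} {p : Fin n → Prop} :
    (∀ i ∈ rotateSet r S, p i) ↔ ∀ i ∈ S, p (i + r) := by
  constructor
  · exact fun h i hi => h _ (add_mem_rotateSet.2 hi)
  · intro h i hi
    obtain ⟨i, rfl⟩ := exists_eq_add_right r i
    exact h i (add_mem_rotateSet.1 hi)

theorem exists_eq_rotateSet (r : Fin n) (S : Finset (Fin n)) : ∃ S', S = rotateSet r S' :=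
  ⟨(Equiv.addRight r).finsetCongr.symm S,
    ((Equiv.addRight r).finsetCongr.apply_symm_apply S).symm⟩

theorem card_rotateSet (r : Fin n) (S : Finset (Fin n)) : (rotateSet r S).card = S.card :=
  Finset.card_map _

theorem rotateSet_subset {r : Fin n} {S T : Finset (Fin n)} :
    rotateSet r S ⊆ rotateSet r T ↔ S ⊆ T :=
  Finset.map_subset_map

theorem ncard_setOf_rotateSet (r : Fin n) (P : Finset (Fin n) → Prop) :
    {S | P (rotateSet r S)}.ncard = {S | P S}.ncard := by
  rw [← Set.ncard_image_of_injective {S | P (rotateSet r S)} (Finset.map_injective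
    (Equiv.addRight r).toEmbedding)]
  congr 1
  ext S
  obtain ⟨S, rfl⟩ := exists_eq_rotateSet r S
  constructor
  · rintro ⟨S', hS', h⟩
    rw [← h]
    exact hS'
  · exact fun hS => ⟨S, hS, rfl⟩

theorem followsIn_rotateSet {r i j : Fin n} {S : Finset (Fin n)} :
    FollowsIn (rotateSet r S) (i + r) (j + r) ↔ FollowsIn S i j := by
  simp only [FollowsIn, add_mem_rotateSet, ne_eq, add_left_inj, forall_mem_rotateSet,
    sbtw_add_right_iff]

theorem isSide_rotateSet {r : Fin n} {e : Sym2 (Fin n)} {S : Finset (Fin n)} :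
    IsSide (rotateSet r S) (e.map (· + r)) ↔ IsSide S e := by
  induction e with
  | _ x y =>
    rw [Sym2.map_mk, isSide_mk_iff, isSide_mk_iff, followsIn_rotateSet, followsIn_rotateSet]

theorem isBoundary_map_add {r : Fin n} {e : Sym2 (Fin n)} :
    IsBoundary (e.map (· + r)) ↔ IsBoundary e := by
  induction e with
  | _ x y =>
    have h : ∀ i : Fin n, s(x + r, y + r) = s(i + r, i + r + 1) ↔ s(x, y) = s(i, i + 1) := by
      intro i
      rw [add_right_comm, Sym2.eq_iff, Sym2.eq_iff]
      simp only [add_left_inj]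
    constructor
    · rintro ⟨i, hi⟩
      obtain ⟨i, rfl⟩ := exists_eq_add_right r i
      exact ⟨i, (h i).1 hi⟩
    · rintro ⟨i, hi⟩
      exact ⟨i + r, (h i).2 hi⟩

omit [NeZero n] in
theorem crosses_add_right_iff (i j k l r : Fin n) :
    Crosses (i + r) (j + r) (k + r) (l + r) ↔ Crosses i j k l := by
  simp only [Crosses, sbtw_add_right_iff]

namespace Dissection

/-- The dissection `D`, rotated so that the vertex `i + r` becomes `i`. -/
def rotate (D : Dissection n) (r : Fin n) : Dissection n where
  arcs := {e | e.map (· + r) ∈ D.arcs}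
  not_isDiag e he hd := by
    induction e with
    | _ x y =>
      refine D.not_isDiag _ he ?_
      rw [Sym2.mk_isDiag_iff] at hd
      rw [Sym2.map_mk, Sym2.mk_isDiag_iff, hd]
  not_crosses i j k l h h' hc :=
    D.not_crosses _ _ _ _ h h' ((crosses_add_right_iff i j k l r).2 hc)

variable {D : Dissection n} {r : Fin n}

theorem rotate_rotate_neg (D : Dissection n) (r : Fin n) : (D.rotate r).rotate (-r) = D := by
  have h : ((D.rotate r).rotate (-r)).arcs = D.arcs := by
    ext e
    induction e with
    | _ x y =>
      change ((s(x, y)).map (· + -r)).map (· + r) ∈ D.arcs ↔ _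
      simp
  generalize (D.rotate r).rotate (-r) = D' at h
  cases D
  cases D'
  simpa only [Dissection.mk.injEq] using h

theorem isCell_rotate_iff {S : Finset (Fin n)} :
    (D.rotate r).IsCell S ↔ D.IsCell (rotateSet r S) := by
  refine and_congr (by rw [card_rotateSet]) (and_congr ?_ ?_)
  · constructor
    · intro h e he
      obtain ⟨e, rfl⟩ : ∃ e', e = Sym2.map (· + r) e' := by
        induction e with
        | _ x y => exact ⟨s(x - r, y - r), by simp⟩
      rw [isBoundary_map_add]
      exact h e (isSide_rotateSet.1 he)
    · intro h e he
      have := h _ (isSide_rotateSet.2 he)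
      rwa [isBoundary_map_add] at this
  · rw [forall_mem_rotateSet]
    refine forall_congr' fun i => forall_congr' fun _ => ?_
    rw [forall_mem_rotateSet]
    refine forall_congr' fun j => forall_congr' fun _ => ?_
    rw [← isSide_rotateSet (r := r)]
    rfl

theorem IsTriQuad.rotate (h : D.IsTriQuad) (r : Fin n) : (D.rotate r).IsTriQuad := by
  intro S hS
  rw [← card_rotateSet r]
  exact h _ (isCell_rotate_iff.1 hS)

theorem IsTriangulation.rotate (h : D.IsTriangulation) (r : Fin n) :
    (D.rotate r).IsTriangulation := by
  intro S hS
  rw [← card_rotateSet r]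
  exact h _ (isCell_rotate_iff.1 hS)

theorem isTowerOn_rotate_iff {W : Finset (Fin n)} :
    (D.rotate r).IsTowerOn W ↔ D.IsTowerOn (rotateSet r W) := by
  have h : ∀ p : Finset (Fin n) → Prop, (∀ S, p (rotateSet r S)) ↔ ∀ S, p S := fun p =>
    ⟨fun h S => by
      obtain ⟨S, rfl⟩ := exists_eq_rotateSet r S
      exact h S, fun h S => h _⟩
  have hv : ∀ p : Fin n → Prop, (∀ v, p (v + r)) ↔ ∀ v, p v := fun p =>
    ⟨fun h v => by
      obtain ⟨v, rfl⟩ := exists_eq_add_right r v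
      exact h v, fun h v => h _⟩
  simp only [IsTowerOn, isCell_rotate_iff]
  refine exists_congr fun k => ?_
  rw [← h fun S => D.IsCell S → S ⊆ rotateSet r W → S.card = 3 ∨ S.card = 4,
    ← ncard_setOf_rotateSet r fun S => D.IsCell S ∧ S ⊆ rotateSet r W ∧ S.card = 3,
    ← ncard_setOf_rotateSet r fun S => D.IsCell S ∧ S ⊆ rotateSet r W ∧ S.card = 4,
    ← hv fun v => {S | D.IsCell S ∧ S ⊆ rotateSet r W ∧ v ∈ S}.ncard ≤ 2]
  have hi : ∀ v, {S | D.IsCell S ∧ S ⊆ rotateSet r W ∧ v + r ∈ S}.ncard =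
      {S | D.IsCell (rotateSet r S) ∧ rotateSet r S ⊆ rotateSet r W ∧
        v + r ∈ rotateSet r S}.ncard := fun v =>
    (ncard_setOf_rotateSet r fun S => D.IsCell S ∧ S ⊆ rotateSet r W ∧ v + r ∈ S).symm
  simp only [hi, card_rotateSet, rotateSet_subset, add_mem_rotateSet]

theorem IsGluingOfTowers.rotate (h : D.IsGluingOfTowers) (r : Fin n) :
    (D.rotate r).IsGluingOfTowers := by
  obtain ⟨E, hE, hW⟩ := h
  exact ⟨E.rotate r, fun e he => hE he,
    fun W h => isTowerOn_rotate_iff.2 (hW _ (isCell_rotate_iff.1 h))⟩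

theorem isGluingOfTowers_rotate_iff :
    (D.rotate r).IsGluingOfTowers ↔ D.IsGluingOfTowers :=
  ⟨fun h => by simpa only [rotate_rotate_neg] using h.rotate (-r), fun h => h.rotate r⟩

theorem separates_rotate_iff {e : Sym2 (Fin n)} {T Q : Finset (Fin n)} :
    (D.rotate r).Separates e T Q ↔
      D.Separates (e.map (· + r)) (rotateSet r T) (rotateSet r Q) := by
  simp only [Separates, isCell_rotate_iff, card_rotateSet, isSide_rotateSet]
  rfl

end Dissection

theorem IsFrieze.rotate {f : Fin n → Fin n → Zsqrtd 2} (hf : IsFrieze f) (r : Fin n) :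
    IsFrieze fun x y => f (x + r) (y + r) where
  eq_zero_iff i j := by rw [hf.eq_zero_iff, add_left_inj]
  next i := by rw [add_right_comm]; exact hf.next _
  prev i := by rw [sub_add_eq_add_sub]; exact hf.prev _
  symm i j := hf.symm _ _
  ptolemy i j k l h := hf.ptolemy _ _ _ _ ((crosses_add_right_iff i j k l r).2 h)

theorem HasCellWeights.rotate {D : Dissection n} {f : Fin n → Fin n → Zsqrtd 2}
    (h : HasCellWeights D f) (r : Fin n) :
    HasCellWeights (D.rotate r) fun x y => f (x + r) (y + r) := by
  classical
  intro S hS x hx y hy hxy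
  have := h _ (Dissection.isCell_rotate_iff.1 hS) _ (add_mem_rotateSet.2 hx) _
    (add_mem_rotateSet.2 hy) (by simpa using hxy)
  refine this.trans (if_congr ?_ rfl rfl)
  exact isSide_rotateSet (e := s(x, y))

theorem IsUnitary.rotate {f : Fin n → Fin n → Zsqrtd 2} (h : IsUnitary f) (r : Fin n) :
    IsUnitary fun x y => f (x + r) (y + r) := by
  obtain ⟨X, hX, hu⟩ := h
  exact ⟨X.rotate r, hX.rotate r, fun i j hij => hu _ _ hij⟩

theorem isUnitary_rotate_iff {f : Fin n → Fin n → Zsqrtd 2} {r : Fin n} :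
    IsUnitary (fun x y => f (x + r) (y + r)) ↔ IsUnitary f :=
  ⟨fun h => by simpa using h.rotate (-r), fun h => h.rotate r⟩

end Rotation

/-! ### The shape of a separated dissection -/

section Separated

variable {n : ℕ} [NeZero n]

namespace Dissection

variable {D : Dissection n}

theorem IsCell.isSide_of_edge {S : Finset (Fin n)} (hS : D.IsCell S) {x y : Fin n} (hx : x ∈ S)
    (hy : y ∈ S) (e : D.Edge x y) : IsSide S s(x, y) :=
  (isSide_iff e.lt).2 ⟨hx, hy, ((isCell_iff.1 hS).2 x hx y hy e.lt).1 e⟩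

/-- Two cells of different size with a common side are separated by that side. -/
theorem IsTriQuad.exists_separates (hD : D.IsTriQuad) {S S' : Finset (Fin n)} (hS : D.IsCell S)
    (hS' : D.IsCell S') (hne : S.card ≠ S'.card) {x y : Fin n} (e : s(x, y) ∈ D.arcs)
    (hxy : x < y) (hx : x ∈ S) (hy : y ∈ S) (hx' : x ∈ S') (hy' : y ∈ S') :
    ∃ T Q, D.Separates s(x, y) T Q := by
  have h1 := hS.isSide_of_edge hx hy (edge_of_mem hxy e)
  have h2 := hS'.isSide_of_edge hx' hy' (edge_of_mem hxy e)
  rcases hD S hS with h | h <;> rcases hD S' hS' with h' | h'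
  · omega
  · exact ⟨S, S', e, hS, h, h1, hS', h', h2⟩
  · exact ⟨S', S, e, hS', h', h2, hS, h, h1⟩
  · omega

/-- If no arc strictly below the edge `(i, j)` separates a triangle from a quadrilateral, then all
cells below `(i, j)` have the size of the one at `(i, j)`. -/
theorem IsTriQuad.card_eq_of_forall_not_separates (hD : D.IsTriQuad) {c : ℕ} (i j : Fin n)
    (e : D.Edge i j)
    (hc : ∀ S, D.IsCell S → i ∈ S → j ∈ S → (∀ k ∈ S, i ≤ k ∧ k ≤ j) → S.card = c)
    (hno : ∀ x y T Q, i ≤ x → y ≤ j → x < y → ¬ (x = i ∧ y = j) → ¬ D.Separates s(x, y) T Q) :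
    ∀ S, D.IsCell S → (∀ k ∈ S, i ≤ k ∧ k ≤ j) → S.card = c := by
  induction hd : j.val - i.val using Nat.strong_induction_on generalizing i j with
  | _ d ih =>
    intro S hS hSb
    obtain ⟨p, hp, q, hq, hpq, epq, hb⟩ := hS.exists_extremes
    have hp' := hSb p hp
    have hq' := hSb q hq
    by_cases hij : p = i ∧ q = j
    · obtain ⟨rfl, rfl⟩ := hij
      exact hc S hS hp hq hb
    obtain ⟨C, hC, hiC, hjC, hCb, -⟩ := exists_cell_below e (by omega)
    have hCc := hc C hC hiC hjC hCb
    have child : ∀ x ∈ C, ∀ y ∈ C, D.Edge x y → ¬ (x = i ∧ y = j) → x ≤ p → q ≤ y →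
        S.card = c := by
      intro x hx y hy exy hne hxp hqy
      have h1 := hCb x hx
      have h2 := hCb y hy
      refine ih _ (by omega) x y exy ?_ (fun x' y' T Q h3 h4 h5 h6 =>
        hno x' y' T Q (by omega) (by omega) h5 (by omega)) rfl S hS
        (fun k hk => by have := hb k hk; omega)
      intro S' hS' hx' hy' _
      by_contra hcard
      have hmem : s(x, y) ∈ D.arcs := by
        rcases exy.cases with h | h | h
        · omega
        · omega
        · exact h
      obtain ⟨T, Q, hTQ⟩ :=
        hD.exists_separates hC hS' (by omega) hmem exy.lt hx hy hx' hy'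
      exact hno x y T Q (by omega) (by omega) exy.lt hne hTQ
    rcases hD C hC with h | h
    · obtain ⟨a, b, d, hab, hbd, rfl⟩ := exists_eq_triple h
      have h1 := hCb a (by simp)
      have h2 := hCb d (by simp)
      simp only [Finset.mem_insert, Finset.mem_singleton] at hiC hjC
      obtain rfl : a = i := by omega
      obtain rfl : d = j := by omega
      obtain ⟨e1, e2, -⟩ := (isCell_triple hab hbd).1 hC
      rcases edge_cases_triangle e1 e2 epq hp'.1 hq'.2 with h | h | h
      · exact child a (by simp) b (by simp) e1 (by omega) (by omega) h
      · exact child b (by simp) d (by simp) e2 (by omega) h (by omega)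
      · exact absurd h hij
    · obtain ⟨a, b, f, d, hab, hbf, hfd, rfl⟩ := exists_eq_quadruple h
      have h1 := hCb a (by simp)
      have h2 := hCb d (by simp)
      simp only [Finset.mem_insert, Finset.mem_singleton] at hiC hjC
      obtain rfl : a = i := by omega
      obtain rfl : d = j := by omega
      obtain ⟨e1, e2, e3, -, n1, n2⟩ := (isCell_quadruple hab hbf hfd).1 hC
      rcases edge_cases_quad e1 e2 e3 n1 n2 epq hp'.1 hq'.2 with h | h | h | h
      · exact child a (by simp) b (by simp) e1 (by omega) (by omega) h
      · exact child b (by simp) f (by simp) e2 (by omega) h.1 h.2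
      · exact child f (by simp) d (by simp) e3 (by omega) h (by omega)
      · exact absurd h hij

/-- Without a separating arc, a dissection consists of triangles only or of quadrilaterals only. -/
theorem IsTriQuad.forall_card_eq (hn : 3 ≤ n) (hD : D.IsTriQuad)
    (hno : ∀ e T Q, ¬ D.Separates e T Q) :
    (∀ S, D.IsCell S → S.card = 3) ∨ ∀ S, D.IsCell S → S.card = 4 := by
  obtain ⟨r, hr⟩ : ∃ r : Fin n, r.val = 0 := ⟨⟨0, by omega⟩, rfl⟩
  obtain ⟨s, hs⟩ : ∃ s : Fin n, s.val + 1 = n := ⟨⟨n - 1, by omega⟩, by simp only; omega⟩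
  have e := D.edge_root (x := r) (y := s) (by omega) hr hs
  obtain ⟨C, hC, hrC, hsC, hCb, -⟩ := exists_cell_below e (by omega)
  have key := hD.card_eq_of_forall_not_separates (c := C.card) r s e
    (fun S hS h1 h2 h3 => by rw [hS.eq_of_extremes hC h1 h2 h3 hrC hsC hCb])
    (fun x y T Q _ _ _ _ => hno _ T Q)
  rcases hD C hC with h | h
  · exact Or.inl fun S hS => (key S hS fun k _ => by omega).trans h
  · exact Or.inr fun S hS => (key S hS fun k _ => by omega).trans h

/-- The position into which a separated dissection with a separating arc can be rotated: `o` is the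
first vertex, the separating arc is `(o, m)`, the cells below it are the quadrilaterals of `D`, the
others are triangles; the quadrilateral at `(o, m)` has the vertices `o`, `o + 1`, `m - 1`, `m`, and
the triangle on the other side has the further vertex `t`. -/
structure IsNormalized (D : Dissection n) (o m t : Fin n) : Prop where
  zero : o.val = 0
  three_le : 3 ≤ m.val
  lt : m < t
  card_inner : ∀ S, D.IsCell S → (∀ k ∈ S, k ≤ m) → S.card = 4
  card_outer : ∀ S, D.IsCell S → ¬ (∀ k ∈ S, k ≤ m) → S.card = 3
  isCell_quad : ∀ a b, a.val = 1 → b.val + 1 = m.val → D.IsCell {o, a, b, m}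
  isCell_triangle : D.IsCell {o, m, t}

/-- If `(o, m)` is the only separating arc and borders the triangle `{o, m, t}` above it, then all
cells which are not below `(o, m)` are triangles. The induction runs through the edges `(o, j)` with
`m < j`. -/
theorem IsTriQuad.card_outer_of_separates (hD : D.IsTriQuad)
    (huniq : {e | ∃ T Q, D.Separates e T Q}.Subsingleton) {o m t : Fin n} (ho : o.val = 0)
    (hom : o < m) (hmt : m < t) (hsep : ∃ T Q, D.Separates s(o, m) T Q)
    (hT : D.IsCell {o, m, t}) (j : Fin n) (hj : m < j) (e : D.Edge o j) :
    ∀ S, D.IsCell S → (∀ k ∈ S, k ≤ j) → ¬ (∀ k ∈ S, k ≤ m) → S.card = 3 := by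
  obtain ⟨eom, emt, eot⟩ := (isCell_triple hom hmt).1 hT
  have hno : ∀ x y T Q, x < y → D.Separates s(x, y) T Q → x = o ∧ y = m := by
    intro x y T Q hxy h
    have h1 : s(x, y) = s(o, m) := huniq ⟨T, Q, h⟩ hsep
    rcases Sym2.eq_iff.1 h1 with h2 | h2
    · exact h2
    · omega
  induction j using WellFoundedLT.induction with
  | _ j ih =>
    obtain ⟨C, hC, hoC, hjC, hCb, -⟩ := exists_cell_below e (by omega)
    -- the cell `C` at `(o, j)` is a triangle with its middle vertex outside of `[o, m)`
    obtain ⟨k, hk, hmk, hkj, eok, ekj⟩ : ∃ k, C = {o, k, j} ∧ m ≤ k ∧ k < j ∧ D.Edge o k ∧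
        D.Edge k j := by
      rcases hD C hC with h | h
      · obtain ⟨a, b, d, hab, hbd, rfl⟩ := exists_eq_triple h
        have h1 := hCb a (by simp)
        have h2 := hCb d (by simp)
        simp only [Finset.mem_insert, Finset.mem_singleton] at hoC hjC
        obtain rfl : a = o := by omega
        obtain rfl : d = j := by omega
        obtain ⟨e1, e2, -⟩ := (isCell_triple hab hbd).1 hC
        refine ⟨b, rfl, ?_, hbd, e1, e2⟩
        by_contra hbm
        exact eom.not_cross e2 hab (by omega) hj
      · exfalso
        obtain ⟨a, b, f, d, hab, hbf, hfd, rfl⟩ := exists_eq_quadruple h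
        have h1 := hCb a (by simp)
        have h2 := hCb d (by simp)
        simp only [Finset.mem_insert, Finset.mem_singleton] at hoC hjC
        obtain rfl : a = o := by omega
        obtain rfl : d = j := by omega
        obtain ⟨e1, e2, e3, -, n1, n2⟩ := (isCell_quadruple hab hbf hfd).1 hC
        rcases lt_trichotomy b m with hb | rfl | hb
        · rcases lt_trichotomy f m with hf | rfl | hf
          · exact eom.not_cross e3 (by omega) hf hj
          · exact n1 eom
          · exact eom.not_cross e2 hab hb hf
        · rcases lt_trichotomy t f with hf | rfl | hf
          · exact eot.not_cross e2 hab hmt hf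
          · exact n1 eot
          · rcases lt_trichotomy t d with hd | rfl | hd
            · exact emt.not_cross e3 hbf hf hd
            · exact n2 emt
            · exact e.not_cross emt hab (by omega) hd
        · obtain ⟨C', hC', hoC', hbC', hCb', -⟩ := exists_cell_below e1 (by omega)
          have h3 := ih b (by omega) hb e1 C' hC' (fun k hk => (hCb' k hk).2)
            fun hall => by have := hall b hbC'; omega
          have hmem : s(a, b) ∈ D.arcs := by
            rcases e1.cases with h | h | h
            · omega
            · omega
            · exact h
          obtain ⟨T, Q, hTQ⟩ := hD.exists_separates hC hC' (by omega) hmem hab (by simp)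
            (by simp) hoC' hbC'
          have := hno _ _ T Q hab hTQ
          omega
    intro S hS hSj hSm
    obtain ⟨p, hp, q, hq, hpq, epq, hb⟩ := hS.exists_extremes
    rcases edge_cases_triangle eok ekj epq (by omega) (hSj q hq) with h | h | ⟨rfl, rfl⟩
    · rcases hmk.eq_or_lt with rfl | hmk
      · exact absurd (fun x hx => (hb x hx).2.trans h) hSm
      · exact ih k hkj hmk eok S hS (fun x hx => (hb x hx).2.trans h) hSm
    · refine hD.card_eq_of_forall_not_separates k j ekj ?_ ?_ S hS
        (fun x hx => ⟨h.trans (hb x hx).1, hSj x hx⟩)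
      · intro S' hS' hk' hj' hb'
        by_contra hcard
        have hC3 : C.card = 3 := by rw [hk, card_triple (by omega) hkj]
        have hqj := hSj q hq
        have hmem : s(k, j) ∈ D.arcs := by
          rcases ekj.cases with h | h | h
          · omega
          · omega
          · exact h
        obtain ⟨T, Q, hTQ⟩ := hD.exists_separates hC hS' (by omega) hmem hkj (by simp [hk])
          hjC hk' hj'
        have := hno _ _ T Q hkj hTQ
        omega
      · intro x y T Q hx hy hxy _ hTQ
        have := hno _ _ T Q hxy hTQ
        omega
    · rw [hS.eq_of_extremes hC hp hq hb hoC hjC hCb, hk, card_triple (by omega) hkj]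

theorem IsTriQuad.exists_isNormalized (hD : D.IsTriQuad)
    (huniq : {e | ∃ T Q, D.Separates e T Q}.Subsingleton) {o w y z : Fin n} (ho : o.val = 0)
    {T Q : Finset (Fin n)} (hsep : D.Separates s(w, o) T Q) (hwo : FollowsIn Q w o)
    (hoy : FollowsIn Q o y) (hyz : FollowsIn Q y z) (hzw : FollowsIn Q z w)
    (hb : IsBoundary s(o, y)) (hb' : IsBoundary s(z, w)) : ∃ m t, D.IsNormalized o m t := by
  have how : o < w := by have := hwo.2.2.1; omega
  have hlt : o < y := by have := hoy.2.2.1; omega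
  obtain ⟨he, hTc, hT3, hTs, hQc, hQ4, hQs⟩ := id hsep
  rw [followsIn_iff_of_gt how] at hwo
  rw [followsIn_iff_of_lt hlt] at hoy
  have hzw' : z < w := by
    have h1 := (hwo.2.2 z hzw.1).2
    exact lt_of_le_of_ne h1 hzw.2.2.1
  have hyz' : y < z := by
    rcases lt_or_gt_of_ne hyz.2.2.1 with h | h
    · exact h
    · exfalso
      rw [followsIn_iff_of_gt h] at hyz
      have h1 := hyz.2.2 o hwo.1
      have h2 := hyz.2.2 w hwo.2.1
      have h3 := (hwo.2.2 y hoy.2.1).2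
      have h4 : Q ⊆ {o, w} := fun k hk => by
        have h5 := hoy.2.2 k hk
        have h6 := hwo.2.2 k hk
        simp only [Finset.mem_insert, Finset.mem_singleton]
        omega
      have := Finset.card_le_card h4
      have := Finset.card_le_two (a := o) (b := w)
      omega
  have hQ : {o, y, z, w} = Q := by
    refine Finset.eq_of_subset_of_card_le ?_ (by rw [card_quadruple hlt hyz' hzw', hQ4])
    simp [Finset.insert_subset_iff, hwo.1, hwo.2.1, hoy.2.1, hzw.1]
  rw [isBoundary_iff hlt] at hb
  rw [isBoundary_iff hzw'] at hb'
  have hyv : y.val = 1 := by omega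
  have hzv : z.val + 1 = w.val := by omega
  rw [Sym2.eq_swap] at hTs hsep
  obtain ⟨hoT, hwT, -⟩ := (isSide_iff how).1 hTs
  obtain ⟨a, b, t, hab, hbt, rfl⟩ := exists_eq_triple hT3
  simp only [Finset.mem_insert, Finset.mem_singleton] at hoT hwT
  obtain rfl : a = o := by omega
  obtain rfl : b = w := by
    rcases hwT with h | h | h
    · omega
    · exact h.symm
    · subst h
      have := hTc.eq_of_extremes hQc (i := a) (j := w) (by simp) (by simp) (by simp; omega)
        hwo.1 hwo.2.1 hwo.2.2
      rw [this] at hT3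
      omega
  have hno : ∀ x y T Q, x < y → D.Separates s(x, y) T Q → x = a ∧ y = b := by
    intro x y T Q hxy h
    have h1 : s(x, y) = s(a, b) := huniq ⟨T, Q, h⟩ ⟨_, _, hsep⟩
    rcases Sym2.eq_iff.1 h1 with h2 | h2
    · exact h2
    · omega
  have eab : D.Edge a b := ((isCell_triple hab hbt).1 hTc).1
  refine ⟨b, t, ho, by omega, hbt, ?_, ?_, ?_, hTc⟩
  · intro S hS hSb
    refine hD.card_eq_of_forall_not_separates a b eab ?_ ?_ S hS fun k hk => ⟨by omega, hSb k hk⟩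
    · intro S' hS' h1 h2 h3
      rw [hS'.eq_of_extremes hQc h1 h2 h3 hwo.1 hwo.2.1 hwo.2.2, hQ4]
    · intro x y T Q _ _ hxy hne h
      exact hne (hno x y T Q hxy h)
  · obtain ⟨s, hs⟩ : ∃ s : Fin n, s.val + 1 = n := ⟨⟨n - 1, by omega⟩, by simp only; omega⟩
    intro S hS hSb
    exact hD.card_outer_of_separates huniq ho hab hbt ⟨_, _, hsep⟩ hTc s (by omega)
      (D.edge_root (by omega) ho hs) S hS (fun k _ => by omega) hSb
  · intro c d hc hd
    rw [show c = y from Fin.ext (by omega), show d = z from Fin.ext (by omega), hQ]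
    exact hQc

theorem IsSeparated.exists_isNormalized_rotate (hD : D.IsTriQuad) (hs : D.IsSeparated)
    {e : Sym2 (Fin n)} {T Q : Finset (Fin n)} (he : D.Separates e T Q) :
    ∃ r o m t, (D.rotate r).IsNormalized o m t := by
  obtain ⟨w, x, y, z, hwx, hxy, hyz, hzw, rfl, hb, hb'⟩ := hs.2 e T Q he
  obtain ⟨o, ho⟩ : ∃ o : Fin n, o.val = 0 := ⟨⟨0, NeZero.pos n⟩, rfl⟩
  obtain ⟨w, rfl⟩ := exists_eq_add_right x w
  obtain ⟨y, rfl⟩ := exists_eq_add_right x y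
  obtain ⟨z, rfl⟩ := exists_eq_add_right x z
  obtain ⟨T, rfl⟩ := exists_eq_rotateSet x T
  obtain ⟨Q, rfl⟩ := exists_eq_rotateSet x Q
  have hx : x = o + x := by
    rw [show o = 0 from Fin.ext ho, zero_add]
  have he' : s(w + x, x) = (s(w, o)).map (· + x) := by
    rw [Sym2.map_mk, ← hx]
  rw [he', ← separates_rotate_iff] at he
  refine ⟨x, o, (hD.rotate x).exists_isNormalized ?_ ho he (y := y) (z := z)
    ?_ ?_ ?_ ?_ ?_ ?_⟩
  · rintro e₁ ⟨T₁, Q₁, h₁⟩ e₂ ⟨T₂, Q₂, h₂⟩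
    rw [separates_rotate_iff] at h₁ h₂
    exact Sym2.map.injective (add_left_injective x) (hs.1 ⟨_, _, h₁⟩ ⟨_, _, h₂⟩)
  · rwa [← followsIn_rotateSet (r := x), ← hx]
  · rwa [← followsIn_rotateSet (r := x), ← hx]
  · rwa [← followsIn_rotateSet (r := x)]
  · rwa [← followsIn_rotateSet (r := x)]
  · rwa [← isBoundary_map_add (r := x), Sym2.map_mk, ← hx]
  · rwa [← isBoundary_map_add (r := x), Sym2.map_mk]

end Dissection

end Separated

/-! ### Arithmetic of the weights -/

section Arithmetic

variable {n : ℕ} [NeZero n]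

open Dissection

theorem isUnit_zsqrtd_two_iff {z : Zsqrtd 2} :
    IsUnit z ↔ z.re ^ 2 - 2 * z.im ^ 2 = 1 ∨ z.re ^ 2 - 2 * z.im ^ 2 = -1 := by
  rw [Zsqrtd.isUnit_iff_norm_isUnit, Int.isUnit_iff, Zsqrtd.norm_def]
  ring_nf

theorem not_isUnit_of_re_eq_zero {z : Zsqrtd 2} (h : z.re = 0) : ¬ IsUnit z := by
  rw [isUnit_zsqrtd_two_iff, h]
  omega

theorem re_eq_one_of_isUnit {z : Zsqrtd 2} (h : IsUnit z) (him : z.im = 0) (hre : 0 < z.re) :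
    z.re = 1 := by
  rw [isUnit_zsqrtd_two_iff, him] at h
  rcases h with h | h <;> nlinarith

theorem re_pos_of_im_eq_zero {z : Zsqrtd 2} (h : 0 < sqrtTwoToReal z) (him : z.im = 0) :
    0 < z.re := by
  rw [sqrtTwoToReal_apply, him] at h
  simpa using h

theorem im_pos_of_re_eq_zero {z : Zsqrtd 2} (h : 0 < sqrtTwoToReal z) (hre : z.re = 0) :
    0 < z.im := by
  rw [sqrtTwoToReal_apply, hre] at h
  simpa using h

/-- If `a + b√2` and `(q + 1) a + q b √2` are units, then `a = 1`: eliminating `b` shows that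
`2 q + 1` divides `3` or `5`. -/
theorem eq_one_of_units {a b q : ℤ} (ha : 1 ≤ a) (hq : 1 ≤ q)
    (h : a ^ 2 - 2 * b ^ 2 = 1 ∨ a ^ 2 - 2 * b ^ 2 = -1)
    (h' : ((q + 1) * a) ^ 2 - 2 * (q * b) ^ 2 = 1 ∨ ((q + 1) * a) ^ 2 - 2 * (q * b) ^ 2 = -1) :
    a = 1 := by
  have key : ((q + 1) * a) ^ 2 - 2 * (q * b) ^ 2 =
      q ^ 2 * (a ^ 2 - 2 * b ^ 2) + (2 * q + 1) * a ^ 2 := by ring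
  rw [key] at h'
  have ha2 : 1 ≤ a ^ 2 := by nlinarith
  rcases h with h | h <;> rw [h] at h'
  · rcases h' with h' | h' <;> nlinarith
  · have hdvd : 2 * q + 1 ∣ 5 ∨ 2 * q + 1 ∣ 3 := by
      rcases h' with h' | h'
      · exact Or.inl ⟨4 * a ^ 2 - (2 * q - 1), by linear_combination -4 * h'⟩
      · exact Or.inr ⟨(2 * q - 1) - 4 * a ^ 2, by linear_combination 4 * h'⟩
    have hq2 : q ≤ 2 := by
      rcases hdvd with hd | hd
      · have := Int.le_of_dvd (by norm_num) hd
        omega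
      · have := Int.le_of_dvd (by norm_num) hd
        omega
    interval_cases q
    · omega
    · have : a ^ 2 = 1 := by omega
      nlinarith

/-- `a + b√2` and `q a + (q + 1) b √2` cannot both be units. -/
theorem not_units {a b q : ℤ} (hb : 1 ≤ b) (hq : 1 ≤ q)
    (h : a ^ 2 - 2 * b ^ 2 = 1 ∨ a ^ 2 - 2 * b ^ 2 = -1)
    (h' : (q * a) ^ 2 - 2 * ((q + 1) * b) ^ 2 = 1 ∨ (q * a) ^ 2 - 2 * ((q + 1) * b) ^ 2 = -1) :
    False := by
  have key : (q * a) ^ 2 - 2 * ((q + 1) * b) ^ 2 =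
      q ^ 2 * (a ^ 2 - 2 * b ^ 2) - 2 * (2 * q + 1) * b ^ 2 := by ring
  rw [key] at h'
  have hb2 : 1 ≤ b ^ 2 := by nlinarith
  rcases h with h | h <;> rw [h] at h'
  · have hdvd : 2 * q + 1 ∣ 3 ∨ 2 * q + 1 ∣ 5 := by
      rcases h' with h' | h'
      · exact Or.inl ⟨(2 * q - 1) - 8 * b ^ 2, by linear_combination -4 * h'⟩
      · exact Or.inr ⟨8 * b ^ 2 - (2 * q - 1), by linear_combination 4 * h'⟩
    have hq2 : q ≤ 2 := by
      rcases hdvd with hd | hd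
      · have := Int.le_of_dvd (by norm_num) hd
        omega
      · have := Int.le_of_dvd (by norm_num) hd
        omega
    interval_cases q <;> omega
  · rcases h' with h' | h' <;> nlinarith

section Quadrilaterals

variable {D : Dissection n} {F : Fin n → Fin n → Zsqrtd 2} {M : Fin n}

theorem below_of_card_eq_four (hq : ∀ S, D.IsCell S → (∀ k ∈ S, k ≤ M) → S.card = 4)
    {i j : Fin n} (e : D.Edge i j) (hj : j ≤ M) (hij : i.val + 1 < j.val) :
    ∃ k l, i < k ∧ k < l ∧ l < j ∧ D.Edge i k ∧ D.Edge k l ∧ D.Edge l j ∧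
      D.IsCell {i, k, l, j} := by
  obtain ⟨S, hS, hi, hj', hb, -⟩ := exists_cell_below e hij
  obtain ⟨a, b, c, d, hab, hbc, hcd, rfl⟩ :=
    exists_eq_quadruple (hq S hS fun k hk => (hb k hk).2.trans hj)
  have h1 := hb a (by simp)
  have h2 := hb d (by simp)
  simp only [Finset.mem_insert, Finset.mem_singleton] at hi hj'
  obtain rfl : a = i := by omega
  obtain rfl : d = j := by omega
  have := (isCell_quadruple hab hbc hcd).1 hS
  exact ⟨b, c, hab, hbc, hcd, this.1, this.2.1, this.2.2.1, hS⟩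

/-- In a region of quadrilaterals, edges join vertices of different parity, and relative to an edge
`(i, j)` the weights are integers or integer multiples of `√2` according to parity. -/
theorem IsWeighting.parity_of_edge (hF : IsWeighting D F)
    (hq : ∀ S, D.IsCell S → (∀ k ∈ S, k ≤ M) → S.card = 4) (i j : Fin n) (e : D.Edge i j)
    (hj : j ≤ M) :
    (j.val - i.val) % 2 = 1 ∧ ∀ x, i ≤ x → x ≤ j →
      ((x.val - i.val) % 2 = 0 → (F i x).re = 0 ∧ (F x j).im = 0) ∧
      ((x.val - i.val) % 2 = 1 → (F i x).im = 0 ∧ (F x j).re = 0) := by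
  induction hd : j.val - i.val using Nat.strong_induction_on generalizing i j with
  | _ d ih =>
    have hlt := e.lt
    have hends : (j.val - i.val) % 2 = 1 → ∀ x, x = i ∨ x = j →
        ((x.val - i.val) % 2 = 0 → (F i x).re = 0 ∧ (F x j).im = 0) ∧
        ((x.val - i.val) % 2 = 1 → (F i x).im = 0 ∧ (F x j).re = 0) := by
      rintro hodd x (rfl | rfl)
      · rw [hF.diag, hF.edge _ _ e]
        simp
      · rw [hF.diag, hF.edge _ _ e, hodd]
        simp
    rcases (by omega : j.val = i.val + 1 ∨ i.val + 1 < j.val) with hij | hij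
    · exact ⟨by omega, fun x hx hx' => hends (by omega) x (by omega)⟩
    obtain ⟨k, l, hik, hkl, hlj, e1, e2, e3, hC⟩ := below_of_card_eq_four hq e hj hij
    obtain ⟨o1, p1⟩ := ih _ (by omega) i k e1 (by omega) rfl
    obtain ⟨o2, p2⟩ := ih _ (by omega) k l e2 (by omega) rfl
    obtain ⟨o3, p3⟩ := ih _ (by omega) l j e3 (by omega) rfl
    refine ⟨by omega, fun x hx hx' => ?_⟩
    rcases le_total x k with h | h
    · have := p1 x hx h
      rw [hF.quad_left hik hkl hlj hC hx h]
      simp only [Zsqrtd.re_add, Zsqrtd.im_add, Zsqrtd.re_mul, Zsqrtd.im_mul, Zsqrtd.re_sqrtd,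
        Zsqrtd.im_sqrtd]
      omega
    rcases le_total x l with h' | h'
    · have := p2 x h h'
      obtain ⟨q1, q2⟩ := hF.quad_middle hik hkl hlj hC h h'
      rw [q1, q2]
      simp only [Zsqrtd.re_add, Zsqrtd.im_add, Zsqrtd.re_mul, Zsqrtd.im_mul, Zsqrtd.re_sqrtd,
        Zsqrtd.im_sqrtd]
      omega
    · have := p3 x h' hx'
      rw [hF.quad_right hik hkl hlj hC h' hx']
      simp only [Zsqrtd.re_add, Zsqrtd.im_add, Zsqrtd.re_mul, Zsqrtd.im_mul, Zsqrtd.re_sqrtd,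
        Zsqrtd.im_sqrtd]
      omega

theorem IsWeighting.parity (hF : IsWeighting D F)
    (hq : ∀ S, D.IsCell S → (∀ k ∈ S, k ≤ M) → S.card = 4) {o : Fin n} (ho : o.val = 0)
    (e : D.Edge o M) {x y : Fin n} (hxy : x ≤ y) (hy : y ≤ M) :
    ((y.val - x.val) % 2 = 0 → (F x y).re = 0) ∧ ((y.val - x.val) % 2 = 1 → (F x y).im = 0) := by
  obtain ⟨hodd, h⟩ := hF.parity_of_edge hq o M e le_rfl
  have hx := h x (by omega) (by omega)
  have hy' := h y (by omega) hy
  have hp := hF.ptolemy o x y M (by omega) hxy hy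
  rw [hF.edge _ _ e] at hp
  have hp' : F x y = F o y * F x M - F o x * F y M := by linear_combination -hp
  rw [hp']
  simp only [Zsqrtd.re_sub, Zsqrtd.im_sub, Zsqrtd.re_mul, Zsqrtd.im_mul]
  constructor <;> intro hpar
  · rcases Nat.mod_two_eq_zero_or_one x.val with hx2 | hx2
    · rw [(hx.1 (by omega)).1, (hx.1 (by omega)).2, (hy'.1 (by omega)).1, (hy'.1 (by omega)).2]
      ring
    · rw [(hx.2 (by omega)).1, (hx.2 (by omega)).2, (hy'.2 (by omega)).1, (hy'.2 (by omega)).2]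
      ring
  · rcases Nat.mod_two_eq_zero_or_one x.val with hx2 | hx2
    · rw [(hx.1 (by omega)).1, (hx.1 (by omega)).2, (hy'.2 (by omega)).1, (hy'.2 (by omega)).2]
      ring
    · rw [(hx.2 (by omega)).1, (hx.2 (by omega)).2, (hy'.1 (by omega)).1, (hy'.1 (by omega)).2]
      ring

/-- A triangulation by arcs of unit weight has no arc inside a region of quadrilaterals: the
triangle below it would have two vertices of the same parity, whose weight is divisible
by `√2`. -/
theorem IsWeighting.not_edge_of_units (hF : IsWeighting D F)
    (hq : ∀ S, D.IsCell S → (∀ k ∈ S, k ≤ M) → S.card = 4) {o : Fin n} (ho : o.val = 0)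
    (e : D.Edge o M) {X : Dissection n} (hX : X.IsTriangulation)
    (hu : ∀ x y, X.Edge x y → IsUnit (F x y)) {x y : Fin n} (hxy : X.Edge x y) (hy : y ≤ M)
    (hlt : x.val + 1 < y.val) : False := by
  obtain ⟨k, hxk, hky, e1, e2⟩ := hX.below hxy hlt
  rcases (by omega : (k.val - x.val) % 2 = 0 ∨ (y.val - k.val) % 2 = 0 ∨
    (y.val - x.val) % 2 = 0) with h | h | h
  · exact not_isUnit_of_re_eq_zero ((hF.parity hq ho e hxk.le (by omega)).1 h) (hu _ _ e1)
  · exact not_isUnit_of_re_eq_zero ((hF.parity hq ho e hky.le hy).1 h) (hu _ _ e2)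
  · exact not_isUnit_of_re_eq_zero ((hF.parity hq ho e hxy.lt.le hy).1 h) (hu _ _ hxy)

end Quadrilaterals

/-! ### Unitary friezes come from ladders -/

namespace Dissection

/-- The quadrilaterals below the edge from the first vertex to `m` are the quadrilaterals with
vertices `i`, `i + 1`, `m - i - 1`, `m - i`, that is, each is glued to the opposite side of the one
before. -/
def IsLadder (D : Dissection n) (m : Fin n) : Prop :=
  ∀ i k l j : Fin n, k.val = i.val + 1 → j.val = l.val + 1 → k < l → i.val + j.val = m.val →
    D.IsCell {i, k, l, j}

namespace IsNormalized

variable {D : Dissection n} {o m t : Fin n} {F : Fin n → Fin n → Zsqrtd 2}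

theorem isTriQuad (N : D.IsNormalized o m t) : D.IsTriQuad := by
  intro S hS
  by_cases h : ∀ k ∈ S, k ≤ m
  · exact Or.inr (N.card_inner S hS h)
  · exact Or.inl (N.card_outer S hS h)

theorem lt_m (N : D.IsNormalized o m t) : o < m := by
  have := N.zero
  have := N.three_le
  omega

theorem edges (N : D.IsNormalized o m t) : D.Edge o m ∧ D.Edge m t ∧ D.Edge o t :=
  (isCell_triple N.lt_m N.lt).1 N.isCell_triangle

theorem below_outer (N : D.IsNormalized o m t) {i j : Fin n} (e : D.Edge i j) (hj : m < j)
    (hij : i.val + 1 < j.val) :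
    ∃ k, i < k ∧ k < j ∧ D.Edge i k ∧ D.Edge k j := by
  obtain ⟨S, hS, hi, hj', hb, -⟩ := exists_cell_below e hij
  obtain ⟨a, b, c, hab, hbc, rfl⟩ :=
    exists_eq_triple (N.card_outer S hS fun h => by have := h j hj'; omega)
  have h1 := hb a (by simp)
  have h2 := hb c (by simp)
  simp only [Finset.mem_insert, Finset.mem_singleton] at hi hj'
  obtain rfl : a = i := by omega
  obtain rfl : c = j := by omega
  have := (isCell_triple hab hbc).1 hS
  exact ⟨b, hab, hbc, this.1, this.2.1⟩

/-- Outside of the quadrilaterals, the weights relative to an edge are integers. -/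
theorem im_eq_zero_of_edge (N : D.IsNormalized o m t) (hF : IsWeighting D F) (i j : Fin n)
    (e : D.Edge i j) (hj : m < j) :
    ∀ x, i ≤ x → x ≤ j → x = o ∨ m ≤ x → (F i x).im = 0 ∧ (F x j).im = 0 := by
  induction hd : j.val - i.val using Nat.strong_induction_on generalizing i j with
  | _ d ih =>
    intro x hix hxj hx
    have ho := N.zero
    rcases (by omega : x = i ∨ x = j ∨ (i < x ∧ x < j)) with rfl | rfl | ⟨hix', hxj'⟩
    · rw [hF.diag, hF.edge _ _ e]
      simp
    · rw [hF.diag, hF.edge _ _ e]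
      simp
    obtain ⟨k, hik, hkj, e1, e2⟩ := N.below_outer e hj (by omega)
    rcases lt_trichotomy x k with h | rfl | h
    · obtain ⟨a1, a2⟩ := ih _ (by omega) i k e1 (by omega) rfl x hix h.le hx
      rw [hF.triangle_left e1 e2 e hix h.le, Zsqrtd.im_add, a1, a2]
      simp
    · rw [hF.edge _ _ e1, hF.edge _ _ e2]
      simp
    · obtain ⟨a1, a2⟩ := ih _ (by omega) k j e2 hj rfl x h.le hxj hx
      rw [hF.triangle_right e1 e2 e h.le hxj, Zsqrtd.im_add, a1, a2]
      simp

theorem im_eq_zero (N : D.IsNormalized o m t) (hF : IsWeighting D F) {x y : Fin n} (hxy : x ≤ y)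
    (hx : x = o ∨ m ≤ x) (hy : y = o ∨ m ≤ y) : (F x y).im = 0 := by
  have ho := N.zero
  have hmt := N.lt
  obtain ⟨s, hs⟩ : ∃ s : Fin n, s.val + 1 = n := ⟨⟨n - 1, by omega⟩, by simp only; omega⟩
  have e := D.edge_root (x := o) (y := s) (by omega) ho hs
  obtain ⟨a1, a2⟩ := N.im_eq_zero_of_edge hF o s e (by omega) x (by omega) (by omega) hx
  obtain ⟨b1, b2⟩ := N.im_eq_zero_of_edge hF o s e (by omega) y (by omega) (by omega) hy
  have hp := hF.ptolemy o x y s (by omega) hxy (by omega)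
  rw [hF.edge _ _ e] at hp
  have hp' : F x y = F o y * F x s - F o x * F y s := by linear_combination -hp
  rw [hp', Zsqrtd.im_sub, Zsqrtd.im_mul, Zsqrtd.im_mul, a1, a2, b1, b2]
  ring

/-- The weight of `(v, s)` for `v` among the quadrilaterals and `s` among the triangles. -/
theorem weight_eq (N : D.IsNormalized o m t) (hF : IsWeighting D F) {v s : Fin n} (hv : v ≤ m)
    (hs : m ≤ s) : F v s = F o v * F m s + F o s * F v m := by
  have := hF.ptolemy o v m s (by have := N.zero; omega) hv hs
  rw [hF.edge _ _ N.edges.1] at this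
  linear_combination this

/-- The weights of the arcs from `s` between `m` and `t` to the ends of the separating arc. -/
theorem outer_left (N : D.IsNormalized o m t) (hF : IsWeighting D F) {s : Fin n} (hs : m < s)
    (hst : s < t) : F o s = F m s + F s t ∧ 0 < (F o s).re ∧ 0 < (F m s).re ∧ 0 < (F s t).re ∧
      (F o s).im = 0 ∧ (F m s).im = 0 ∧ (F s t).im = 0 := by
  have hom := N.lt_m
  have h := hF.ptolemy o m s t hom.le hs.le hst.le
  rw [hF.edge _ _ N.edges.1, hF.edge _ _ N.edges.2.1, hF.edge _ _ N.edges.2.2] at h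
  have i1 : (F o s).im = 0 := N.im_eq_zero hF (by omega) (by simp) (by omega)
  have i2 : (F m s).im = 0 := N.im_eq_zero hF hs.le (by simp) (by omega)
  have i3 : (F s t).im = 0 := N.im_eq_zero hF hst.le (by omega) (by omega)
  exact ⟨by linear_combination h,
    re_pos_of_im_eq_zero (hF.pos N.isTriQuad (by omega)) i1,
    re_pos_of_im_eq_zero (hF.pos N.isTriQuad hs) i2,
    re_pos_of_im_eq_zero (hF.pos N.isTriQuad hst) i3, i1, i2, i3⟩

/-- The weights of the arcs from `s` beyond `t` to the ends of the separating arc. -/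
theorem outer_right (N : D.IsNormalized o m t) (hF : IsWeighting D F) {s : Fin n} (hs : t < s) :
    F m s = F o s + F t s ∧ 0 < (F o s).re ∧ 0 < (F m s).re ∧ 0 < (F t s).re ∧
      (F o s).im = 0 ∧ (F m s).im = 0 ∧ (F t s).im = 0 := by
  have hom := N.lt_m
  have hmt := N.lt
  have h := hF.ptolemy o m t s hom.le hmt.le hs.le
  rw [hF.edge _ _ N.edges.1, hF.edge _ _ N.edges.2.1, hF.edge _ _ N.edges.2.2] at h
  have i1 : (F o s).im = 0 := N.im_eq_zero hF (by omega) (by simp) (by omega)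
  have i2 : (F m s).im = 0 := N.im_eq_zero hF (by omega) (by simp) (by omega)
  have i3 : (F t s).im = 0 := N.im_eq_zero hF hs.le (by omega) (by omega)
  exact ⟨by linear_combination h,
    re_pos_of_im_eq_zero (hF.pos N.isTriQuad (by omega)) i1,
    re_pos_of_im_eq_zero (hF.pos N.isTriQuad (by omega)) i2,
    re_pos_of_im_eq_zero (hF.pos N.isTriQuad hs) i3, i1, i2, i3⟩

/-- An arc which separates `t` from the quadrilaterals does not have unit weight. -/
theorem not_isUnit_of_lt_of_lt (N : D.IsNormalized o m t) (hF : IsWeighting D F) {s w : Fin n}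
    (hs : m < s) (hst : s < t) (htw : t < w) : ¬ IsUnit (F s w) := by
  intro hu
  obtain ⟨h1, h2, h3, h4, h5, h6, h7⟩ := N.outer_left hF hs hst
  obtain ⟨k1, k2, k3, k4, k5, k6, k7⟩ := N.outer_right hF htw
  have i : (F s w).im = 0 := N.im_eq_zero hF (by omega) (by omega) (by omega)
  have hre := re_eq_one_of_isUnit hu i
    (re_pos_of_im_eq_zero (hF.pos N.isTriQuad (by omega)) i)
  have h := hF.ptolemy o m s w N.lt_m.le hs.le (by omega)
  rw [hF.edge _ _ N.edges.1] at h
  have h' := congrArg Zsqrtd.re h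
  have e1 := congrArg Zsqrtd.re h1
  have e2 := congrArg Zsqrtd.re k1
  simp only [Zsqrtd.re_add, Zsqrtd.re_mul, one_mul] at h' e1 e2
  rw [hre, h5, h6, k5, k6, e1, e2] at h'
  nlinarith [mul_pos h3 k4, mul_pos k2 h4, mul_pos h4 k4]

section Triangulation

variable {X : Dissection n}

/-- A triangulation by arcs of unit weight does not join a vertex `v ≤ m - 2` to a vertex `s`
between `m` and `t`. Passing through the triangles on the far side of `(v, s)`, one would otherwise
arrive at such an arc with `t` as the third vertex of the triangle. Then `(v, s)` and `(v, t)` are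
units and `(s, t)` has weight `1`, which is impossible by arithmetic. -/
theorem not_edge_left (N : D.IsNormalized o m t) (hF : IsWeighting D F) (hX : X.IsTriangulation)
    (hu : ∀ x y, X.Edge x y → IsUnit (F x y)) (v s : Fin n) (e : X.Edge v s)
    (hv : v.val + 2 ≤ m.val) (hs : m < s) (hst : s < t) : False := by
  induction hd : v.val + (t.val - s.val) using Nat.strong_induction_on generalizing v s with
  | _ d ih =>
    obtain ⟨h1, h2, h3, h4, h5, h6, h7⟩ := N.outer_left hF hs hst
    have ho := N.zero
    have h1r := congrArg Zsqrtd.re h1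
    rw [Zsqrtd.re_add] at h1r
    by_cases hvo : v = o
    · subst hvo
      have := re_eq_one_of_isUnit (hu _ _ e) h5 h2
      omega
    obtain ⟨w, ⟨hw, -, ew⟩ | ⟨hw, ew, ew'⟩⟩ := hX.above e (Or.inl (by omega))
    · exact ih _ (by omega) w s ew (by omega) hs hst rfl
    rcases lt_trichotomy w t with hwt | rfl | hwt
    · exact ih _ (by omega) v w ew hv (by omega) hwt rfl
    · have hst1 := re_eq_one_of_isUnit (hu _ _ ew') h7 h4
      have u1 := hu _ _ ew
      have u2 := hu _ _ e
      rw [N.weight_eq hF (by omega) N.lt.le, hF.edge _ _ N.edges.2.1, hF.edge _ _ N.edges.2.2,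
        mul_one, one_mul, isUnit_zsqrtd_two_iff] at u1
      rw [N.weight_eq hF (by omega) hs.le, isUnit_zsqrtd_two_iff] at u2
      simp only [Zsqrtd.re_add, Zsqrtd.im_add, Zsqrtd.re_mul, Zsqrtd.im_mul, h5, h6,
        mul_zero, zero_mul, add_zero, zero_add] at u1 u2
      have p1 := hF.parity N.card_inner ho N.edges.1 (x := o) (y := v) (by omega) (by omega)
      have p2 := hF.parity N.card_inner ho N.edges.1 (x := v) (y := m) (by omega) le_rfl
      have hm := (hF.parity_of_edge N.card_inner o m N.edges.1 le_rfl).1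
      have hp1 := hF.pos N.isTriQuad (x := o) (y := v) (by omega)
      have hp2 := hF.pos N.isTriQuad (x := v) (y := m) (by omega)
      rw [h1r, hst1] at u2
      rcases Nat.mod_two_eq_zero_or_one v.val with hpar | hpar
      · have a1 := p1.1 (by omega)
        have a2 := p2.2 (by omega)
        have b2 := re_pos_of_im_eq_zero hp2 a2
        rw [a1, a2] at u1 u2
        simp only [add_zero, zero_add, mul_zero, zero_mul] at u1 u2
        have key := eq_one_of_units (a := (F v m).re) (b := (F o v).im) (q := (F m s).re)
          (by omega) (by omega) u1 (by convert u2 using 3 <;> ring)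
        -- but the weight of `(v, m)` is at least `3`
        obtain ⟨a, ha⟩ : ∃ a : Fin n, a.val = 1 := ⟨⟨1, by omega⟩, rfl⟩
        obtain ⟨b, hb⟩ : ∃ b : Fin n, b.val + 1 = m.val :=
          ⟨⟨m.val - 1, by omega⟩, by simp only; omega⟩
        have hq := (hF.quad_middle (by omega) (by omega) (by omega) (N.isCell_quad a b ha hb)
          (x := v) (by omega) (by omega)).2
        have r1 := (hF.parity N.card_inner ho N.edges.1 (x := a) (y := v) (by omega)
          (by omega)).2 (by omega)
        have r2 := (hF.parity N.card_inner ho N.edges.1 (x := v) (y := b) (by omega)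
          (by omega)).1 (by omega)
        have r3 := re_pos_of_im_eq_zero (hF.pos N.isTriQuad (x := a) (y := v) (by omega)) r1
        have r4 := im_pos_of_re_eq_zero (hF.pos N.isTriQuad (x := v) (y := b) (by omega)) r2
        have := congrArg Zsqrtd.re hq
        simp only [Zsqrtd.re_add, Zsqrtd.re_mul, Zsqrtd.re_sqrtd, Zsqrtd.im_sqrtd] at this
        omega
      · have a1 := p1.2 (by omega)
        have a2 := p2.1 (by omega)
        have b2 := im_pos_of_re_eq_zero hp2 a2
        rw [a1, a2] at u1 u2
        simp only [add_zero, zero_add, mul_zero, zero_mul] at u1 u2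
        exact not_units (a := (F o v).re) (b := (F v m).im) (q := (F m s).re)
          (by omega) (by omega) u1 (by convert u2 using 3 <;> ring)
    · exact N.not_isUnit_of_lt_of_lt hF hs hst hwt (hu _ _ ew')

/-- The mirror image of `not_edge_left`; here `t` lies on the near side of `(v, s)`. -/
theorem not_edge_right (N : D.IsNormalized o m t) (hF : IsWeighting D F)
    (hX : X.IsTriangulation) (hu : ∀ x y, X.Edge x y → IsUnit (F x y)) (v s : Fin n)
    (e : X.Edge v s) (hv : 2 ≤ v.val) (hvm : v ≤ m) (hst : t < s) : False := by
  induction hd : (m.val - v.val) + (s.val - t.val) using Nat.strong_induction_on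
    generalizing v s with
  | _ d ih =>
    obtain ⟨h1, h2, h3, h4, h5, h6, h7⟩ := N.outer_right hF hst
    have ho := N.zero
    have hmt := N.lt
    have h1r := congrArg Zsqrtd.re h1
    rw [Zsqrtd.re_add] at h1r
    by_cases hvo : v = m
    · subst hvo
      have := re_eq_one_of_isUnit (hu _ _ e) h6 h3
      omega
    obtain ⟨w, hvw, hws, ew, ew'⟩ := hX.below e (by omega)
    rcases le_or_gt w m with hwm | hwm
    · exact ih _ (by omega) w s ew' (by omega) hwm hst rfl
    rcases lt_trichotomy w t with hwt | rfl | hwt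
    · exact N.not_isUnit_of_lt_of_lt hF hwm hwt hst (hu _ _ ew')
    · have hst1 := re_eq_one_of_isUnit (hu _ _ ew') h7 h4
      have u1 := hu _ _ ew
      have u2 := hu _ _ e
      rw [N.weight_eq hF (by omega) N.lt.le, hF.edge _ _ N.edges.2.1, hF.edge _ _ N.edges.2.2,
        mul_one, one_mul, isUnit_zsqrtd_two_iff] at u1
      rw [N.weight_eq hF (by omega) (by omega), isUnit_zsqrtd_two_iff] at u2
      simp only [Zsqrtd.re_add, Zsqrtd.im_add, Zsqrtd.re_mul, Zsqrtd.im_mul, h5, h6,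
        mul_zero, zero_mul, add_zero, zero_add] at u1 u2
      have p1 := hF.parity N.card_inner ho N.edges.1 (x := o) (y := v) (by omega) (by omega)
      have p2 := hF.parity N.card_inner ho N.edges.1 (x := v) (y := m) (by omega) le_rfl
      have hm := (hF.parity_of_edge N.card_inner o m N.edges.1 le_rfl).1
      have hp1 := hF.pos N.isTriQuad (x := o) (y := v) (by omega)
      have hp2 := hF.pos N.isTriQuad (x := v) (y := m) (by omega)
      rw [h1r, hst1] at u2
      rcases Nat.mod_two_eq_zero_or_one v.val with hpar | hpar
      · have a1 := p1.1 (by omega)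
        have a2 := p2.2 (by omega)
        have b1 := im_pos_of_re_eq_zero hp1 a1
        rw [a1, a2] at u1 u2
        simp only [add_zero, zero_add, mul_zero, zero_mul] at u1 u2
        exact not_units (a := (F v m).re) (b := (F o v).im) (q := (F o s).re)
          (by omega) (by omega) u1 (by convert u2 using 3 <;> ring)
      · have a1 := p1.2 (by omega)
        have a2 := p2.1 (by omega)
        have b1 := re_pos_of_im_eq_zero hp1 a1
        rw [a1, a2] at u1 u2
        simp only [add_zero, zero_add, mul_zero, zero_mul] at u1 u2
        have key := eq_one_of_units (a := (F o v).re) (b := (F v m).im) (q := (F o s).re)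
          (by omega) (by omega) u1 (by convert u2 using 3 <;> ring)
        -- but the weight of `(o, v)` is at least `3`
        obtain ⟨a, ha⟩ : ∃ a : Fin n, a.val = 1 := ⟨⟨1, by omega⟩, rfl⟩
        obtain ⟨b, hb⟩ : ∃ b : Fin n, b.val + 1 = m.val :=
          ⟨⟨m.val - 1, by omega⟩, by simp only; omega⟩
        have hq := (hF.quad_middle (by omega) (by omega) (by omega) (N.isCell_quad a b ha hb)
          (x := v) (by omega) (by omega)).1
        have r1 := (hF.parity N.card_inner ho N.edges.1 (x := a) (y := v) (by omega)
          (by omega)).1 (by omega)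
        have r2 := (hF.parity N.card_inner ho N.edges.1 (x := v) (y := b) (by omega)
          (by omega)).2 (by omega)
        have r3 := im_pos_of_re_eq_zero (hF.pos N.isTriQuad (x := a) (y := v) (by omega)) r1
        have r4 := re_pos_of_im_eq_zero (hF.pos N.isTriQuad (x := v) (y := b) (by omega)) r2
        have := congrArg Zsqrtd.re hq
        simp only [Zsqrtd.re_add, Zsqrtd.re_mul, Zsqrtd.re_sqrtd, Zsqrtd.im_sqrtd] at this
        omega
    · exact ih _ (by omega) v w ew hv hvm hwt rfl

theorem isUnit_of_triangulation (N : D.IsNormalized o m t) (hF : IsWeighting D F)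
    (hX : X.IsTriangulation) (hu : ∀ x y, X.Edge x y → IsUnit (F x y)) {v : Fin n}
    (hv : 2 ≤ v.val) (hvm : v.val + 2 ≤ m.val) : IsUnit (F v t) := by
  have ho := N.zero
  obtain ⟨v', hv'⟩ : ∃ v' : Fin n, v'.val = v.val + 1 := ⟨⟨v.val + 1, by omega⟩, rfl⟩
  obtain ⟨w, ⟨hw, -, e⟩ | ⟨hw, e, -⟩⟩ := hX.above (X.edge_succ hv') (Or.inl (by omega))
  · exact (hF.not_edge_of_units N.card_inner ho N.edges.1 hX hu e (by omega) (by omega)).elim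
  · rcases le_or_gt w m with hwm | hwm
    · exact (hF.not_edge_of_units N.card_inner ho N.edges.1 hX hu e hwm (by omega)).elim
    rcases lt_trichotomy w t with hwt | rfl | hwt
    · exact (N.not_edge_left hF hX hu v w e hvm hwm hwt).elim
    · exact hu _ _ e
    · exact (N.not_edge_right hF hX hu v w e hv (by omega) hwt).elim

end Triangulation

/-- Passing from one rung of the ladder to the next multiplies the weights of the arcs to `t`
by the unit `1 + √2`. -/
theorem weight_step (N : D.IsNormalized o m t) (hF : IsWeighting D F) {i k l j : Fin n}
    (hik : i < k) (hkl : k < l) (hlj : l < j) (hj : j ≤ m) (hC : D.IsCell {i, k, l, j})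
    (h : F i t = F j t) :
    F k t = (1 + Zsqrtd.sqrtd) * F i t ∧ F l t = (1 + Zsqrtd.sqrtd) * F i t := by
  have hmt := N.lt
  obtain ⟨e1, e2, e3, e4, -, -⟩ := (isCell_quadruple hik hkl hlj).1 hC
  obtain ⟨q1, q2⟩ := hF.quad _ _ _ _ hik hkl hlj hC
  have h1 := hF.ptolemy i k j t hik.le (by omega) (by omega)
  have h2 := hF.ptolemy i l j t (by omega) hlj.le (by omega)
  rw [hF.edge _ _ e4, hF.edge _ _ e1, q2, ← h] at h1
  rw [hF.edge _ _ e4, hF.edge _ _ e3, q1, ← h] at h2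
  exact ⟨by linear_combination h1, by linear_combination h2⟩

theorem isUnit_one_add_sqrtd : IsUnit (1 + Zsqrtd.sqrtd : Zsqrtd 2) := by
  rw [isUnit_zsqrtd_two_iff]
  simp

/-- If the arcs from `t` to the vertices of the quadrilaterals have unit weight, then the
quadrilaterals form a ladder. In a rung `(i, j)`, the weight of an arc from `t` to `v` is a unit
times the sum of the weights of `(i, v)` and `(v, j)`; for a next quadrilateral which is not glued
along the opposite side this sum is `1 + (1 + c)√2` with `c ≥ 1` at one of the vertices `v` next to
the rung. -/
theorem isLadder_of_isUnit (N : D.IsNormalized o m t) (hF : IsWeighting D F)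
    (hu : ∀ v : Fin n, 2 ≤ v.val → v.val + 2 ≤ m.val → IsUnit (F v t)) : D.IsLadder m := by
  have ho := N.zero
  have hmt := N.lt
  have main : ∀ c : ℕ, ∀ i k l j : Fin n, i.val = c → k.val = i.val + 1 → j.val = l.val + 1 →
      k < l → i.val + j.val = m.val →
      D.IsCell {i, k, l, j} ∧ F i t = F j t ∧ IsUnit (F i t) := by
    intro c
    induction c with
    | zero =>
      intro i k l j hi hk hj hkl hij
      obtain rfl : i = o := Fin.ext (by omega)
      obtain rfl : j = m := Fin.ext (by omega)
      refine ⟨N.isCell_quad k l (by omega) (by omega), ?_⟩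
      rw [hF.edge _ _ N.edges.2.1, hF.edge _ _ N.edges.2.2]
      simp
    | succ c ih =>
      intro i k l j hi hk hj hkl hij
      obtain ⟨i', hi'⟩ : ∃ i' : Fin n, i'.val = c := ⟨⟨c, by omega⟩, rfl⟩
      obtain ⟨j', hj'⟩ : ∃ j' : Fin n, j'.val = j.val + 1 := ⟨⟨j.val + 1, by omega⟩, rfl⟩
      obtain ⟨hC, h1, h2⟩ := ih i' i j j' hi' (by omega) hj' (by omega) (by omega)
      obtain ⟨s1, s2⟩ := N.weight_step hF (by omega) (by omega) (by omega) (by omega) hC h1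
      have hunit : IsUnit (F i t) := s1 ▸ isUnit_one_add_sqrtd.mul h2
      have heq : F i t = F j t := s1.trans s2.symm
      refine ⟨?_, heq, hunit⟩
      have eij : D.Edge i j :=
        ((isCell_quadruple (by omega) (by omega) (by omega)).1 hC).2.1
      obtain ⟨a, b, hia, hab, hbj, ea, -, eb, hS⟩ :=
        below_of_card_eq_four N.card_inner eij (by omega) (by omega)
      -- the criterion for `v` between `i` and `j`
      have crit : ∀ v, i ≤ v → v ≤ j → IsUnit (F v t) → IsUnit (F i v + F v j) := by
        intro v hiv hvj huv
        have h := hF.ptolemy i v j t hiv hvj (by omega)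
        rw [hF.edge _ _ eij, ← heq] at h
        have h' : F v t = F i t * (F i v + F v j) := by linear_combination h
        exact isUnit_of_mul_isUnit_right (h' ▸ huv)
      have no : ∀ c : ℤ, 0 < c → ∀ z : Zsqrtd 2, z.re = 1 → z.im = 1 + c → ¬ IsUnit z := by
        intro c hc z hre him
        rw [isUnit_zsqrtd_two_iff, hre, him]
        rintro (h | h) <;> nlinarith
      have pos := @IsWeighting.pos _ _ _ _ hF N.isTriQuad
      have par := @IsWeighting.parity _ _ _ _ _ hF N.card_inner o ho N.edges.1
      have oa := (hF.parity_of_edge N.card_inner i a ea (by omega)).1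
      have ob := (hF.parity_of_edge N.card_inner b j eb (by omega)).1
      have ha : a = k := by
        by_contra hak
        have hr := (par (x := k) (y := a) (by omega) (by omega)).1 (by omega)
        have hc := im_pos_of_re_eq_zero (pos (x := k) (y := a) (by omega)) hr
        have hval := hF.quad_left hia hab hbj hS (x := k) (by omega) (by omega)
        have e1 := hF.edge _ _ (D.edge_succ hk)
        refine no _ hc _ ?_ ?_ (crit k (by omega) (by omega) (hu k (by omega) (by omega)))
        · rw [hval, e1]
          simp [hr]
        · rw [hval, e1]
          simp
      have hb : b = l := by
        by_contra hbl
        have hr := (par (x := b) (y := l) (by omega) (by omega)).1 (by omega)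
        have hc := im_pos_of_re_eq_zero (pos (x := b) (y := l) (by omega)) hr
        have hval := hF.quad_right hia hab hbj hS (x := l) (by omega) (by omega)
        have e1 := hF.edge _ _ (D.edge_succ hj)
        refine no _ hc _ ?_ ?_ (crit l (by omega) (by omega) (hu l (by omega) (by omega)))
        · rw [hval, e1]
          simp [hr]
        · rw [hval, e1]
          simp [add_comm]
      rw [← ha, ← hb]
      exact hS
  exact fun i k l j hk hj hkl hij => (main _ i k l j rfl hk hj hkl hij).1

theorem isUnit_of_isLadder (N : D.IsNormalized o m t) (hF : IsWeighting D F)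
    (hL : D.IsLadder m) {v : Fin n} (hv : v ≤ m) : IsUnit (F v t) := by
  have ho := N.zero
  have hmt := N.lt
  have main : ∀ c : ℕ, ∀ i j : Fin n, i.val = c → i < j → i.val + j.val = m.val →
      F i t = F j t ∧ IsUnit (F i t) := by
    intro c
    induction c with
    | zero =>
      intro i j hi hlt hij
      obtain rfl : i = o := Fin.ext (by omega)
      obtain rfl : j = m := Fin.ext (by omega)
      rw [hF.edge _ _ N.edges.2.1, hF.edge _ _ N.edges.2.2]
      simp
    | succ c ih =>
      intro i j hi hlt hij
      obtain ⟨i', hi'⟩ : ∃ i' : Fin n, i'.val = c := ⟨⟨c, by omega⟩, rfl⟩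
      obtain ⟨j', hj'⟩ : ∃ j' : Fin n, j'.val = j.val + 1 := ⟨⟨j.val + 1, by omega⟩, rfl⟩
      obtain ⟨h1, h2⟩ := ih i' j' hi' (by omega) (by omega)
      have hC := hL i' i j j' (by omega) hj' hlt (by omega)
      obtain ⟨s1, s2⟩ := N.weight_step hF (by omega) (by omega) (by omega) (by omega) hC h1
      exact ⟨s1.trans s2.symm, s1 ▸ isUnit_one_add_sqrtd.mul h2⟩
  have hm := (hF.parity_of_edge N.card_inner o m N.edges.1 le_rfl).1
  obtain ⟨w, hw⟩ : ∃ w : Fin n, v.val + w.val = m.val :=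
    ⟨⟨m.val - v.val, by omega⟩, by simp only; omega⟩
  rcases (by omega : v < w ∨ w < v) with h | h
  · exact (main _ v w rfl h hw).2
  · obtain ⟨h1, h2⟩ := main _ w v rfl h (by omega)
    exact h1 ▸ h2

end IsNormalized

end Dissection

end Arithmetic

/-! ### Ladders, gluings of towers and triangulations by units -/

section Constructions

variable {n : ℕ} [NeZero n]

namespace Dissection

omit [NeZero n] in
/-- The dissection whose arcs are the pairs `x < y` with `R x y`. -/
def ofRel (R : Fin n → Fin n → Prop) (hlt : ∀ x y, R x y → x < y)
    (hnc : ∀ a b c d, R a c → R b d → a < b → b < c → c < d → False) : Dissection n where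
  arcs := {e | ∃ x y, R x y ∧ e = s(x, y)}
  not_isDiag := by
    rintro _ ⟨x, y, h, rfl⟩
    rw [Sym2.mk_isDiag_iff]
    exact (hlt x y h).ne
  not_crosses := by
    rintro i j k l ⟨x, y, h, e⟩ ⟨z, w, h', e'⟩ hc
    have h1 := hlt x y h
    have h2 := hlt z w h'
    simp only [Crosses, sbtw_iff] at hc
    have key : (x < z ∧ z < y ∧ y < w) ∨ (z < x ∧ x < w ∧ w < y) := by
      rcases Sym2.eq_iff.1 e with ⟨rfl, rfl⟩ | ⟨rfl, rfl⟩ <;>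
      rcases Sym2.eq_iff.1 e' with ⟨rfl, rfl⟩ | ⟨rfl, rfl⟩ <;> omega
    rcases key with ⟨h3, h4, h5⟩ | ⟨h3, h4, h5⟩
    · exact hnc x z y w h h' h3 h4 h5
    · exact hnc z x w y h' h h3 h4 h5

theorem edge_ofRel_iff {R : Fin n → Fin n → Prop} {hlt : ∀ x y, R x y → x < y}
    {hnc : ∀ a b c d, R a c → R b d → a < b → b < c → c < d → False} {x y : Fin n} :
    (ofRel R hlt hnc).Edge x y ↔ (x < y ∧ IsBoundary s(x, y)) ∨ R x y := by
  constructor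
  · rintro ⟨h, hb | ⟨z, w, h', e⟩⟩
    · exact Or.inl ⟨h, hb⟩
    · rcases Sym2.eq_iff.1 e with ⟨rfl, rfl⟩ | ⟨rfl, rfl⟩
      · exact Or.inr h'
      · exact absurd (hlt _ _ h') h.not_gt
  · rintro (⟨h, hb⟩ | h)
    · exact ⟨h, Or.inl hb⟩
    · exact ⟨hlt x y h, Or.inr ⟨x, y, h, rfl⟩⟩

variable {D : Dissection n}

theorem Edge.mono {E : Dissection n} (h : E.arcs ⊆ D.arcs) {x y : Fin n} (e : E.Edge x y) :
    D.Edge x y :=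
  ⟨e.1, e.2.imp id fun h' => h h'⟩

theorem IsCell.eq_of_subset {S W : Finset (Fin n)} (hS : D.IsCell S) (hW3 : W.card = 3)
    (h : S ⊆ W) : S = W :=
  Finset.eq_of_subset_of_card_le h (hW3 ▸ hS.1)

/-- A triangle is a tower without quadrilaterals. -/
theorem IsCell.isTowerOn {W : Finset (Fin n)} (hW : D.IsCell W) (h3 : W.card = 3) :
    D.IsTowerOn W := by
  refine ⟨0, by omega, fun S hS h => ?_, ?_, ?_, fun v => ?_⟩
  · rw [hS.eq_of_subset h3 h]
    exact Or.inl h3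
  · rw [Set.ncard_eq_one]
    refine ⟨W, Set.eq_singleton_iff_unique_mem.2 ⟨⟨hW, Finset.Subset.refl _, h3⟩, ?_⟩⟩
    exact fun S hS => hS.1.eq_of_subset h3 hS.2.1
  · rw [Set.ncard_eq_zero]
    refine Set.eq_empty_of_forall_notMem fun S hS => ?_
    have := hS.1.eq_of_subset h3 hS.2.1
    have := hS.2.2
    subst S
    omega
  · refine (Set.ncard_le_ncard (t := {W}) fun S hS => hS.1.eq_of_subset h3 hS.2.1).trans ?_
    simp

/-- In a gluing of towers, no gluing arc lies in a region of quadrilaterals, as each tower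
contains a triangle. -/
theorem not_edge_of_forall_isTowerOn {E : Dissection n} (hW : ∀ W, E.IsCell W → D.IsTowerOn W)
    {M : Fin n} (hq : ∀ S, D.IsCell S → (∀ k ∈ S, k ≤ M) → S.card = 4) {x y : Fin n}
    (e : E.Edge x y) (hy : y ≤ M) (hxy : x.val + 1 < y.val) : False := by
  obtain ⟨W, hWc, -, -, hb, -⟩ := exists_cell_below e hxy
  obtain ⟨k, -, -, h3, -⟩ := hW W hWc
  obtain ⟨S, hS⟩ := Set.ncard_eq_one.1 h3
  obtain ⟨h1, h2, h3⟩ : S ∈ {S | D.IsCell S ∧ S ⊆ W ∧ S.card = 3} := by rw [hS]; rfl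
  have := hq S h1 fun k hk => (hb k (h2 hk)).2.trans hy
  omega

namespace IsNormalized

variable {o m t : Fin n}

/-- As no gluing arc lies among the quadrilaterals, a single tower contains all of them, so at most
two quadrilaterals meet in each vertex; this leaves only the ladder. -/
theorem isLadder_of_isGluingOfTowers (N : D.IsNormalized o m t) (hG : D.IsGluingOfTowers) :
    D.IsLadder m := by
  classical
  obtain ⟨E, hED, hW⟩ := hG
  have ho := N.zero
  have hm3 := N.three_le
  have hmt := N.lt
  have hno : ∀ x y, E.Edge x y → y ≤ m → x.val + 1 < y.val → False :=
    fun x y e hy hxy => not_edge_of_forall_isTowerOn hW N.card_inner e hy hxy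
  -- the shortest gluing edge above the quadrilaterals
  obtain ⟨j, hj, hjm⟩ := ((Finset.univ : Finset (Fin n)).filter fun j =>
    E.Edge o j ∧ m < j).exists_min_image id ⟨⟨n - 1, by omega⟩, by
      simp only [Finset.mem_filter, Finset.mem_univ, true_and]
      exact ⟨E.edge_root (Fin.lt_def.2 (by simp only; omega)) ho (by simp only; omega),
        Fin.lt_def.2 (by simp only; omega)⟩⟩
  simp only [Finset.mem_filter, Finset.mem_univ, true_and, id, and_imp] at hj hjm
  obtain ⟨W, hWc, -, -, -, hin⟩ := exists_cell_below hj.1 (by omega)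
  have hsub : ∀ v, v ≤ m → v ∈ W := by
    intro v hv
    refine hin v (by omega) (by omega) fun a b e hoa hbj hav hvb => ?_
    rcases le_or_gt b m with hbm | hbm
    · exact (hno a b e hbm (by omega)).elim
    · rcases hoa.eq_or_lt with rfl | hoa
      · exact ⟨rfl, le_antisymm hbj (hjm b e hbm)⟩
      · exact (N.edges.1.not_cross (e.mono hED) hoa (by omega) hbm).elim
  obtain ⟨-, -, -, -, -, h2⟩ := hW W hWc
  -- three distinct quadrilaterals cannot share a vertex
  have three : ∀ v A B C, v ∈ A → v ∈ B → v ∈ C → D.IsCell A → D.IsCell B → D.IsCell C →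
      (∀ k ∈ A, k ≤ m) → (∀ k ∈ B, k ≤ m) → (∀ k ∈ C, k ≤ m) → A ≠ B → A ≠ C → B ≠ C →
      False := by
    intro v A B C hA hB hC cA cB cC sA sB sC n1 n2 n3
    have h3 : 2 < {S | D.IsCell S ∧ S ⊆ W ∧ v ∈ S}.ncard :=
      (Set.two_lt_ncard_iff (Set.toFinite _)).2 ⟨A, B, C,
        ⟨cA, fun k hk => hsub k (sA k hk), hA⟩, ⟨cB, fun k hk => hsub k (sB k hk), hB⟩,
        ⟨cC, fun k hk => hsub k (sC k hk), hC⟩, n1, n2, n3⟩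
    exact absurd (h2 v) (by omega)
  have main : ∀ c : ℕ, ∀ i k l j : Fin n, i.val = c → k.val = i.val + 1 → j.val = l.val + 1 →
      k < l → i.val + j.val = m.val → D.IsCell {i, k, l, j} := by
    intro c
    induction c with
    | zero =>
      intro i k l j hi hk hj hkl hij
      obtain rfl : i = o := Fin.ext (by omega)
      obtain rfl : j = m := Fin.ext (by omega)
      exact N.isCell_quad k l (by omega) (by omega)
    | succ c ih =>
      intro i k l j hi hk hj hkl hij
      obtain ⟨i', hi'⟩ : ∃ i' : Fin n, i'.val = c := ⟨⟨c, by omega⟩, rfl⟩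
      obtain ⟨j', hj'⟩ : ∃ j' : Fin n, j'.val = j.val + 1 := ⟨⟨j.val + 1, by omega⟩, rfl⟩
      have hP := ih i' i j j' hi' (by omega) hj' (by omega) (by omega)
      have eij : D.Edge i j :=
        ((isCell_quadruple (by omega) (by omega) (by omega)).1 hP).2.1
      obtain ⟨a, b, hia, hab, hbj, ea, -, eb, hS⟩ :=
        below_of_card_eq_four N.card_inner eij (by omega) (by omega)
      have hPm : ∀ k ∈ ({i', i, j, j'} : Finset (Fin n)), k ≤ m := by
        simp only [Finset.mem_insert, Finset.mem_singleton, forall_eq_or_imp, forall_eq]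
        omega
      have hSm : ∀ k ∈ ({i, a, b, j} : Finset (Fin n)), k ≤ m := by
        simp only [Finset.mem_insert, Finset.mem_singleton, forall_eq_or_imp, forall_eq]
        omega
      have hi'S : i' ∉ ({i, a, b, j} : Finset (Fin n)) := by
        simp only [Finset.mem_insert, Finset.mem_singleton]
        omega
      have ha : a = k := by
        by_contra hak
        obtain ⟨C, hC, hiC, -, hCb, -⟩ := exists_cell_below ea (by omega)
        have hi'C : i' ∉ C := fun h => by have := hCb i' h; omega
        have hjC : j ∉ C := fun h => by have := hCb j h; omega
        exact three i {i', i, j, j'} {i, a, b, j} C (by simp) (by simp) hiC hP hS hC hPm hSm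
          (fun k hk => by have := hCb k hk; omega) (fun h => hi'S (h ▸ by simp))
          (fun h => hi'C (h ▸ by simp)) (fun h => hjC (h ▸ by simp))
      have hb : b = l := by
        by_contra hbl
        obtain ⟨C, hC, -, hjC, hCb, -⟩ := exists_cell_below eb (by omega)
        have hi'C : i' ∉ C := fun h => by have := hCb i' h; omega
        have hiC : i ∉ C := fun h => by have := hCb i h; omega
        exact three j {i', i, j, j'} {i, a, b, j} C (by simp) (by simp) hjC hP hS hC hPm hSm
          (fun k hk => by have := hCb k hk; omega) (fun h => hi'S (h ▸ by simp))
          (fun h => hi'C (h ▸ by simp)) (fun h => hiC (h ▸ by simp))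
      rw [← ha, ← hb]
      exact hS
  exact fun i k l j hk hj hkl hij => main _ i k l j rfl hk hj hkl hij

/-- The `c`-th quadrilateral of the ladder below the edge from the first vertex to `m`. -/
def rung (m : Fin n) (c : ℕ) : Finset (Fin n) :=
  Finset.univ.filter fun x =>
    x.val = c ∨ x.val = c + 1 ∨ x.val + c + 1 = m.val ∨ x.val + c = m.val

omit [NeZero n] in
theorem mem_rung {m x : Fin n} {c : ℕ} :
    x ∈ rung m c ↔ x.val = c ∨ x.val = c + 1 ∨ x.val + c + 1 = m.val ∨ x.val + c = m.val := by
  simp [rung]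

omit [NeZero n] in
theorem exists_rung_eq {m : Fin n} {c : ℕ} (h : 2 * c + 3 ≤ m.val) :
    ∃ i k l j : Fin n, rung m c = {i, k, l, j} ∧ i.val = c ∧ k.val = i.val + 1 ∧
      j.val = l.val + 1 ∧ k < l ∧ i.val + j.val = m.val := by
  refine ⟨⟨c, by omega⟩, ⟨c + 1, by omega⟩, ⟨m.val - c - 1, by omega⟩, ⟨m.val - c, by omega⟩,
    ?_, rfl, rfl, ?_, Fin.lt_def.2 ?_, ?_⟩
  · ext x
    simp only [mem_rung, Finset.mem_insert, Finset.mem_singleton, Fin.ext_iff]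
    omega
  · simp only; omega
  · simp only; omega
  · simp only; omega

theorem isCell_rung (hL : D.IsLadder m) {c : ℕ} (h : 2 * c + 3 ≤ m.val) :
    D.IsCell (rung m c) ∧ (rung m c).card = 4 := by
  obtain ⟨i, k, l, j, h1, -, h3, h4, h5, h6⟩ := exists_rung_eq h
  rw [h1]
  exact ⟨hL i k l j h3 h4 h5 h6, card_quadruple (by omega) h5 (by omega)⟩

/-- The only cells below the edge `(o, m)` are the quadrilaterals of the ladder. -/
theorem exists_eq_rung (N : D.IsNormalized o m t) (hodd : m.val % 2 = 1) (hL : D.IsLadder m)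
    {S : Finset (Fin n)} (hS : D.IsCell S) (hSm : ∀ k ∈ S, k ≤ m) :
    ∃ c, 2 * c + 3 ≤ m.val ∧ S = rung m c := by
  have ho := N.zero
  obtain ⟨p, hp, q, hq, hpq, e, hb⟩ := hS.exists_extremes
  have hqm := hSm q hq
  rcases lt_trichotomy (p.val + q.val) m.val with h | h | h
  · exfalso
    obtain ⟨i, k, l, j, -, h2, h3, h4, h5, h6⟩ :=
      exists_rung_eq (m := m) (c := p.val) (by omega)
    obtain rfl : p = i := Fin.ext (by omega)
    obtain ⟨-, e2, -, -, e5, -⟩ :=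
      (isCell_quadruple (by omega) h5 (by omega)).1 (hL p k l j h3 h4 h5 h6)
    rcases (by omega : q < l ∨ q = l) with h7 | rfl
    · exact e.not_cross e2 (by omega) (by omega) h7
    · exact e5 e
  · obtain ⟨i, k, l, j, h1, h2, h3, h4, h5, h6⟩ :=
      exists_rung_eq (m := m) (c := p.val) (by omega)
    obtain rfl : p = i := Fin.ext (by omega)
    obtain rfl : q = j := Fin.ext (by omega)
    refine ⟨p.val, by omega, ?_⟩
    rw [h1]
    exact hS.eq_of_extremes (hL p k l q h3 h4 h5 h6) hp hq hb (by simp) (by simp)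
      (by simp; omega)
  · exfalso
    obtain ⟨i, k, l, j, -, h2, h3, h4, h5, h6⟩ :=
      exists_rung_eq (m := m) (c := m.val - q.val) (by omega)
    obtain rfl : q = j := Fin.ext (by omega)
    obtain ⟨-, e2, -, -, -, e6⟩ :=
      (isCell_quadruple (by omega) h5 (by omega)).1 (hL i k l q h3 h4 h5 h6)
    rcases (by omega : k < p ∨ k = p) with h7 | rfl
    · exact e2.not_cross e h7 (by omega) (by omega)
    · exact e6 e

theorem odd (N : D.IsNormalized o m t) (hn : 3 ≤ n) : m.val % 2 = 1 := by
  obtain ⟨F, hF⟩ := exists_isWeighting hn N.isTriQuad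
  have := (hF.parity_of_edge N.card_inner o m N.edges.1 le_rfl).1
  have := N.zero
  omega

/-- A triangle beyond `m` with a side within `[o, m]` which is not a boundary edge is the one at
`(o, m)`. -/
theorem eq_of_triangle (N : D.IsNormalized o m t) {i k j : Fin n} (hik : i < k) (hkj : k < j)
    (hj : m < j) (e2 : D.Edge k j) (e : D.Edge i j) (hk : k ≤ m)
    (hik' : i.val + 1 < k.val) : i = o ∧ k = m ∧ j = t := by
  have ho := N.zero
  have hmt := N.lt
  obtain ⟨eom, emt, eot⟩ := N.edges
  have hkm : k = m := by
    by_contra hkm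
    exact eom.not_cross e2 (by omega) (by omega) hj
  subst hkm
  have hio : i = o := by
    by_contra hio
    exact eom.not_cross e (by omega) hik hj
  subst hio
  refine ⟨rfl, rfl, ?_⟩
  rcases lt_trichotomy j t with h | h | h
  · exact (e.not_cross emt hik hkj h).elim
  · exact h
  · exact (eot.not_cross e2 hik hmt h).elim

/-- If the quadrilaterals form a ladder, then the ladder and the triangle at its end form a tower,
and the other triangles are towers of their own. -/
theorem isGluingOfTowers_of_isLadder (N : D.IsNormalized o m t) (hodd : m.val % 2 = 1)
    (hL : D.IsLadder m) : D.IsGluingOfTowers := by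
  classical
  have ho := N.zero
  have hm3 := N.three_le
  have hmt := N.lt
  obtain ⟨eom, emt, eot⟩ := N.edges
  let R : Fin n → Fin n → Prop := fun x y => x < y ∧ m < y ∧ s(x, y) ∈ D.arcs
  let E : Dissection n := ofRel R (fun x y h => h.1) fun a b c d h h' h1 h2 h3 =>
    (edge_of_mem h.1 h.2.2).not_cross (edge_of_mem h'.1 h'.2.2) h1 h2 h3
  have hED : E.arcs ⊆ D.arcs := by
    rintro _ ⟨x, y, h, rfl⟩
    exact h.2.2
  have hE : ∀ x y, m < y → (E.Edge x y ↔ D.Edge x y) := by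
    refine fun x y hy => ⟨Edge.mono hED, fun e => edge_ofRel_iff.2 ?_⟩
    rcases e.2 with h | h
    · exact Or.inl ⟨e.1, h⟩
    · exact Or.inr ⟨e.1, hy, h⟩
  have hE' : ∀ x y, E.Edge x y → x.val + 1 < y.val → m < y := by
    intro x y e hxy
    rcases edge_ofRel_iff.1 e with ⟨h1, h2⟩ | h
    · rw [isBoundary_iff h1] at h2
      omega
    · exact h.2.1
  -- the ladder together with the triangle at its end
  let W₀ : Finset (Fin n) := insert t (Finset.Iic m)
  have hW₀ : ∀ x, x ∈ W₀ ↔ x = t ∨ x ≤ m := fun x => by simp [W₀]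
  have hW₀c : W₀.card = m.val + 2 := by
    rw [Finset.card_insert_of_notMem (by simpa using hmt), Fin.card_Iic]
  have hW₀E : E.IsCell W₀ := by
    refine isCell_iff.2 ⟨by omega, fun x hx y hy hxy => ?_⟩
    rw [hW₀] at hx hy
    constructor
    · intro e
      rcases (by omega : y.val = x.val + 1 ∨ x.val + 1 < y.val) with h | h
      · exact Or.inl fun k _ => by omega
      · have hmy := hE' x y e h
        obtain rfl : y = t := by omega
        by_cases hxo : x = o
        · exact Or.inr fun k hk => by rw [hW₀] at hk; omega
        by_cases hxm : x = m
        · exact Or.inl fun k hk => by rw [hW₀] at hk; omega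
        exact (eom.not_cross (e.mono hED) (by omega) (by omega) hmy).elim
    · rintro (h | h)
      · rcases hy with rfl | hy
        · obtain rfl : x = m := by
            by_contra hxm
            exact h m ((hW₀ m).2 (Or.inr le_rfl)) ⟨by omega, hmt⟩
          exact (hE _ _ hmt).2 emt
        · refine E.edge_succ ?_
          by_contra hxy'
          obtain ⟨z, hz⟩ : ∃ z : Fin n, z.val = x.val + 1 := ⟨⟨x.val + 1, by omega⟩, rfl⟩
          exact h z ((hW₀ z).2 (by omega)) ⟨by omega, by omega⟩
      · have h1 := h o ((hW₀ o).2 (by omega))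
        have h2 := h t ((hW₀ t).2 (Or.inl rfl))
        obtain rfl : x = o := by omega
        obtain rfl : y = t := by omega
        exact (hE _ _ hmt).2 eot
  have tri : ∀ S, D.IsCell S → S ⊆ W₀ → S.card = 3 → S = {o, m, t} := by
    intro S hS hSW h3
    obtain ⟨a, b, c, hab, hbc, rfl⟩ := exists_eq_triple h3
    have ha := (hW₀ a).1 (hSW (by simp))
    have hb := (hW₀ b).1 (hSW (by simp))
    have hc := (hW₀ c).1 (hSW (by simp))
    obtain ⟨e1, e2, e3⟩ := (isCell_triple hab hbc).1 hS
    obtain rfl : c = t := by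
      by_contra hct
      have := N.card_inner _ hS (by
        simp only [Finset.mem_insert, Finset.mem_singleton, forall_eq_or_imp, forall_eq]
        omega)
      omega
    have hao : a = o ∨ a = m := by
      by_contra h
      exact eom.not_cross e3 (by omega) (by omega) hmt
    have hbo : b = o ∨ b = m := by
      by_contra h
      exact eom.not_cross e2 (by omega) (by omega) hmt
    rw [show a = o by omega, show b = m by omega]
  have quad : ∀ S, D.IsCell S → S ⊆ W₀ → S.card = 4 → ∀ k ∈ S, k ≤ m := by
    intro S hS hSW h4
    by_contra h
    have := N.card_outer S hS h
    omega
  have hT₀ : ({o, m, t} : Finset (Fin n)) ⊆ W₀ := by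
    intro x hx
    rw [hW₀]
    simp only [Finset.mem_insert, Finset.mem_singleton] at hx
    omega
  have hrung : ∀ c, 2 * c + 3 ≤ m.val → rung m c ⊆ W₀ := by
    intro c hc x hx
    rw [mem_rung] at hx
    rw [hW₀]
    omega
  have tower₀ : D.IsTowerOn W₀ := by
    refine ⟨m.val / 2, by omega, fun S hS _ => N.isTriQuad S hS, ?_, ?_, fun v => ?_⟩
    · rw [Set.ncard_eq_one]
      refine ⟨{o, m, t}, Set.eq_singleton_iff_unique_mem.2 ⟨?_, ?_⟩⟩
      · exact ⟨N.isCell_triangle, hT₀, card_triple N.lt_m hmt⟩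
      · exact fun S hS => tri S hS.1 hS.2.1 hS.2.2
    · have himg : {S | D.IsCell S ∧ S ⊆ W₀ ∧ S.card = 4} =
          rung m '' (Finset.range (m.val / 2) : Set ℕ) := by
        ext S
        constructor
        · rintro ⟨h1, h2, h3⟩
          obtain ⟨c, hc, rfl⟩ := N.exists_eq_rung hodd hL h1 (quad S h1 h2 h3)
          exact ⟨c, by simp only [Finset.coe_range, Set.mem_Iio]; omega, rfl⟩
        · rintro ⟨c, hc, rfl⟩
          simp only [Finset.coe_range, Set.mem_Iio] at hc
          have hc' : 2 * c + 3 ≤ m.val := by omega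
          obtain ⟨h1, h2⟩ := isCell_rung hL hc'
          exact ⟨h1, hrung c hc', h2⟩
      rw [himg, Set.InjOn.ncard_image, Set.ncard_coe_finset, Finset.card_range]
      intro c hc d hd hcd
      simp only [Finset.coe_range, Set.mem_Iio] at hc hd
      have h1 : (⟨c, by omega⟩ : Fin n) ∈ rung m d := by
        rw [← hcd, mem_rung]
        exact Or.inl rfl
      have h2 : (⟨d, by omega⟩ : Fin n) ∈ rung m c := by
        rw [hcd, mem_rung]
        exact Or.inl rfl
      rw [mem_rung] at h1 h2
      simp only at h1 h2
      omega
    · -- number the triangle and the quadrilaterals along the tower: a vertex lies in at most two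
      -- consecutive ones
      let C : ℕ → Finset (Fin n) := fun c => if c = 0 then {o, m, t} else rung m (c - 1)
      have hC : ∀ S ∈ {S | D.IsCell S ∧ S ⊆ W₀ ∧ v ∈ S},
          S = C (min v.val (m.val - v.val)) ∨ S = C (min v.val (m.val - v.val) + 1) := by
        rintro S ⟨h1, h2, h3⟩
        rcases N.isTriQuad S h1 with h | h
        · obtain rfl := tri S h1 h2 h
          left
          have : min v.val (m.val - v.val) = 0 := by
            simp only [Finset.mem_insert, Finset.mem_singleton] at h3
            omega
          simp [C, this]
        · obtain ⟨c, hc, rfl⟩ := N.exists_eq_rung hodd hL h1 (quad S h1 h2 h)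
          rw [mem_rung] at h3
          rcases (by omega : min v.val (m.val - v.val) = c + 1 ∨
            min v.val (m.val - v.val) = c) with h | h
          · left
            simp [C, h]
          · right
            simp [C, h]
      refine (Set.ncard_le_ncard (t := {C (min v.val (m.val - v.val)),
        C (min v.val (m.val - v.val) + 1)}) hC).trans ?_
      exact (Set.ncard_insert_le _ _).trans (by rw [Set.ncard_singleton])
  refine ⟨E, hED, fun W hW => ?_⟩
  obtain ⟨i, hi, j, hj, hij, e, hb⟩ := hW.exists_extremes
  have hmj := hE' i j e hij
  obtain ⟨k, hik, hkj, e1, e2⟩ := N.below_outer (e.mono hED) hmj hij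
  by_cases h : i.val + 1 < k.val ∧ k ≤ m
  · obtain ⟨rfl, rfl, rfl⟩ := N.eq_of_triangle hik hkj hmj e2 (e.mono hED) h.2 h.1
    rw [hW.eq_of_extremes hW₀E hi hj hb ((hW₀ i).2 (by omega)) ((hW₀ j).2 (by omega))
      (fun x hx => by rw [hW₀] at hx; omega)]
    exact tower₀
  · have e1' : E.Edge i k := by
      rcases (by omega : k.val = i.val + 1 ∨ m < k) with h' | h'
      · exact E.edge_succ h'
      · exact (hE _ _ h').2 e1
    have hT : D.IsCell {i, k, j} := (isCell_triple hik hkj).2 ⟨e1, e2, e.mono hED⟩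
    have hT' : E.IsCell {i, k, j} := (isCell_triple hik hkj).2 ⟨e1', (hE _ _ hmj).2 e2, e⟩
    rw [hW.eq_of_extremes hT' hi hj hb (by simp) (by simp) (by simp; omega)]
    exact hT.isTowerOn (card_triple hik hkj)

/-- If the arcs from `t` to the vertices of the quadrilaterals have unit weight, then the fan of
these arcs together with the triangles of `D` beyond `t` is a triangulation by arcs of unit
weight. -/
theorem exists_triangulation_of_isUnit (N : D.IsNormalized o m t)
    {F : Fin n → Fin n → Zsqrtd 2} (hF : IsWeighting D F)
    (hu : ∀ v, v ≤ m → IsUnit (F v t)) :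
    ∃ X : Dissection n, X.IsTriangulation ∧ ∀ x y, X.Edge x y → IsUnit (F x y) := by
  have ho := N.zero
  have hm3 := N.three_le
  have hmt := N.lt
  obtain ⟨eom, emt, eot⟩ := N.edges
  let R : Fin n → Fin n → Prop := fun x y => (D.Edge x y ∧ m < y) ∨ (x ≤ m ∧ y = t)
  have hnc : ∀ a b c d, R a c → R b d → a < b → b < c → c < d → False := by
    rintro a b c d (⟨h, hc⟩ | ⟨h, rfl⟩) (⟨h', hd⟩ | ⟨h', rfl⟩) h1 h2 h3
    · exact h.not_cross h' h1 h2 h3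
    · by_cases hao : a = o
      · subst hao
        exact h.not_cross emt N.lt_m hc h3
      · exact eom.not_cross h (by omega) (by omega) hc
    · rcases lt_or_ge b m with hbm | hbm
      · exact eom.not_cross h' (by omega) hbm hd
      · exact eot.not_cross h' (by omega) h2 h3
    · exact lt_irrefl _ h3
  let X : Dissection n := ofRel R
    (by rintro x y (⟨h, -⟩ | ⟨h, rfl⟩)
        · exact h.lt
        · omega) hnc
  have hX : ∀ x y, X.Edge x y ↔ (x < y ∧ IsBoundary s(x, y)) ∨ R x y :=
    fun x y => edge_ofRel_iff
  refine ⟨X, isTriangulation_of_below fun i j e hij => ?_, fun x y e => ?_⟩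
  · have hR : R i j := by
      rcases (hX i j).1 e with ⟨h1, h2⟩ | h
      · have h2' := (isBoundary_iff h1).1 h2
        exact Or.inl ⟨⟨h1, Or.inl h2⟩, by omega⟩
      · exact h
    have fan : ∀ i : Fin n, i < m → ∃ k, i < k ∧ k < t ∧ X.Edge i k ∧ X.Edge k t := by
      intro i him
      obtain ⟨k, hk⟩ : ∃ k : Fin n, k.val = i.val + 1 := ⟨⟨i.val + 1, by omega⟩, rfl⟩
      exact ⟨k, by omega, by omega, X.edge_succ hk, (hX _ _).2 (Or.inr (Or.inr ⟨by omega, rfl⟩))⟩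
    have outer : D.Edge i j → m < j → ∃ k, i < k ∧ k < j ∧ X.Edge i k ∧ X.Edge k j := by
      intro e' hmj
      obtain ⟨k, hik, hkj, e1, e2⟩ := N.below_outer e' hmj hij
      by_cases h : i.val + 1 < k.val ∧ k ≤ m
      · obtain ⟨rfl, rfl, rfl⟩ := N.eq_of_triangle hik hkj hmj e2 e' h.2 h.1
        exact fan i hik
      · refine ⟨k, hik, hkj, ?_, (hX _ _).2 (Or.inr (Or.inl ⟨e2, hmj⟩))⟩
        rcases (by omega : k.val = i.val + 1 ∨ m < k) with h' | h'
        · exact X.edge_succ h'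
        · exact (hX _ _).2 (Or.inr (Or.inl ⟨e1, h'⟩))
    rcases hR with ⟨e', hmj⟩ | ⟨him, rfl⟩
    · exact outer e' hmj
    · rcases him.eq_or_lt with rfl | him
      · exact outer emt hmt
      · exact fan i him
  · rcases (hX x y).1 e with ⟨h1, h2⟩ | ⟨h, -⟩ | ⟨h, rfl⟩
    · rw [hF.edge _ _ ⟨h1, Or.inl h2⟩]
      exact isUnit_one
    · rw [hF.edge _ _ h]
      exact isUnit_one
    · exact hu x h

end IsNormalized

end Dissection

/-! ### Unitary friezes and gluings of towers -/

open Dissection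

theorem isUnitary_iff_exists_edge {f : Fin n → Fin n → Zsqrtd 2} (hf : IsFrieze f) :
    IsUnitary f ↔
      ∃ X : Dissection n, X.IsTriangulation ∧ ∀ x y, X.Edge x y → IsUnit (f x y) := by
  refine exists_congr fun X => and_congr_right fun hX => ⟨fun h x y e => ?_, fun h x y e => ?_⟩
  · rcases e.2 with ⟨i, hi⟩ | he
    · rcases Sym2.eq_iff.1 hi with ⟨rfl, rfl⟩ | ⟨rfl, rfl⟩
      · rw [hf.next]
        exact isUnit_one
      · rw [hf.symm, hf.next]
        exact isUnit_one
    · exact h x y he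
  · rcases lt_trichotomy x y with hxy | rfl | hxy
    · exact h x y (edge_of_mem hxy e)
    · exact absurd rfl (X.not_isDiag _ e)
    · rw [hf.symm]
      exact h y x (edge_of_mem hxy (Sym2.eq_swap ▸ e))

theorem Dissection.IsNormalized.isUnitary_iff (hn : 3 ≤ n) {D : Dissection n} {o m t : Fin n}
    (N : D.IsNormalized o m t) {f : Fin n → Fin n → Zsqrtd 2} (hf : IsFrieze f)
    (hc : HasCellWeights D f) : IsUnitary f ↔ D.IsGluingOfTowers := by
  have hF := hf.isWeighting hc
  rw [isUnitary_iff_exists_edge hf]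
  constructor
  · rintro ⟨X, hX, hu⟩
    exact N.isGluingOfTowers_of_isLadder (N.odd hn)
      (N.isLadder_of_isUnit hF fun v hv hvm => N.isUnit_of_triangulation hF hX hu hv hvm)
  · intro hG
    exact N.exists_triangulation_of_isUnit hF fun v hv =>
      N.isUnit_of_isLadder hF (N.isLadder_of_isGluingOfTowers hG) hv

theorem isUnitary_iff_isGluingOfTowers (hn : 3 ≤ n) {D : Dissection n} (hD : D.IsTriQuad)
    (hs : D.IsSeparated) {f : Fin n → Fin n → Zsqrtd 2} (hf : IsFrieze f)
    (hc : HasCellWeights D f) : IsUnitary f ↔ D.IsGluingOfTowers := by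
  by_cases hsep : ∃ e T Q, D.Separates e T Q
  · obtain ⟨e, T, Q, he⟩ := hsep
    obtain ⟨r, o, m, t, N⟩ := hs.exists_isNormalized_rotate hD he
    rw [← isUnitary_rotate_iff (r := r), ← isGluingOfTowers_rotate_iff (r := r)]
    exact N.isUnitary_iff hn (hf.rotate r) (hc.rotate r)
  push Not at hsep
  have hF := hf.isWeighting hc
  rw [isUnitary_iff_exists_edge hf]
  rcases hD.forall_card_eq hn hsep with h | h
  · refine iff_of_true ⟨D, h, fun x y e => ?_⟩
      ⟨D, Set.Subset.refl _, fun W hW => hW.isTowerOn (h W hW)⟩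
    rw [hF.edge _ _ e]
    exact isUnit_one
  · obtain ⟨o, ho⟩ : ∃ o : Fin n, o.val = 0 := ⟨⟨0, by omega⟩, rfl⟩
    obtain ⟨l, hl⟩ : ∃ l : Fin n, l.val + 1 = n := ⟨⟨n - 1, by omega⟩, by simp only; omega⟩
    have hol : o < l := by omega
    have hq : ∀ S, D.IsCell S → (∀ k ∈ S, k ≤ l) → S.card = 4 := fun S hS _ => h S hS
    refine iff_of_false ?_ ?_
    · rintro ⟨X, hX, hu⟩
      exact hF.not_edge_of_units hq ho (D.edge_root hol ho hl) hX hu (X.edge_root hol ho hl)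
        le_rfl (by omega)
    · rintro ⟨E, -, hE⟩
      exact not_edge_of_forall_isTowerOn hE hq (E.edge_root hol ho hl) le_rfl (by omega)

end Constructions

end PolygonFrieze

theorem mainTheorem4 (n : ℕ) [NeZero n] (hn : 3 ≤ n) (D : PolygonFrieze.Dissection n)
    (hD : D.IsTriQuad) (hsep : D.IsSeparated) :
    (∃! f : Fin n → Fin n → Zsqrtd 2, PolygonFrieze.IsFriezeFromDissection D f) ∧
    ∀ f : Fin n → Fin n → Zsqrtd 2, PolygonFrieze.IsFriezeFromDissection D f →
      (PolygonFrieze.IsUnitary f ↔ D.IsGluingOfTowers) := by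
  refine ⟨PolygonFrieze.existsUnique_isFriezeFromDissection hn hD, fun f hf => ?_⟩
  obtain ⟨hf, hc⟩ := (PolygonFrieze.isFriezeFromDissection_iff hD).1 hf
  exact PolygonFrieze.isUnitary_iff_isGluingOfTowers hn hD hsep hf hc
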